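/- **Setting.** Let $V$ be a real vector space of finite dimension with a norm $\|\cdot\|$, and let $\langle\cdot,\cdot\rangle_1$ be a nondegenerate symmetric bilinear form on $V$ of signature $(-,+,\dots,+)$; put $|v|_1=\sqrt{|\langle v,v\rangle_1|}$. Fix a time-orientation of $(V,\langle\cdot,\cdot\rangle_1)$ and let $\mathfrak T$ be the set of future pointing causal vectors, i.e. of the $v\in V\setminus\{0\}$ with $\langle v,v\rangle_1\le 0$ that are positively time-oriented. For $\varepsilon>0$ let $\mathfrak T_\varepsilon=\{v\in\mathfrak T : \operatorname{dist}(v,\partial\mathfrak T)\ge\varepsilon\|v\|\}$, where the distance is taken with respect to $\|\cdot\|$. Let $\Gamma\subset V$ be a co-compact lattice and $f\colon V\to(0,\infty)$ a smooth $\Gamma$-invariant function. Let $d$ be the time separation (Lorentzian distance) of $(V,f^2\langle\cdot,\cdot\rangle_1)$: $d(x,y)\in[0,\infty]$ is the supremum of the lengths $\int_a^b f(\gamma)\,|\dot\gamma|_1\,dt$ of the piecewise smooth future pointing causal curves $\gamma\colon[a,b]\to V$ from $x$ to $y$, and $d(x,y)=0$ if there is no such curve. **Proposition 3.1.** For all $x\in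 V$ and $v\in\mathfrak T$, $d(x,x+v)<\infty$. There is a positively homogeneous (of degree one) concave function $\mathfrak l\colon\mathfrak T\to[0,\infty)$ such that: 1. for every $\varepsilon>0$ there is a constant $K(\varepsilon)>0$ with $|\mathfrak l(v)-d(x,x+v)|\le K(\varepsilon)$ for all $v\in\mathfrak T_\varepsilon$ and all $x\in V$; 2. $\inf f\,|v|_1\le\mathfrak l(v)\le\sup f\,|v|_1$ for all $v\in\mathfrak T$; 3. $\mathfrak l(v+w)\ge\mathfrak l(v)+\mathfrak l(w)$ for all $v,w\in\mathfrak T$; 4. $\mathfrak l(v)=\lim_{n\to\infty}\frac{d(x,x+nv)}{n}$ for all $v\in\mathfrak T$ and all $x\in V$; in particular the limit exists and does not depend on $x$. -/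

import Mathlib

open Set Filter
open scoped Topology ContDiff

/-- A symmetric bilinear form on a real vector space which is nondegenerate of signature
`(-, +, …, +)`: there is a pseudo-orthonormal basis `e₀, …, eₙ` with `⟨e₀, e₀⟩ = -1` and
`⟨eᵢ, eᵢ⟩ = 1` for `i ≠ 0`. -/
def IsLorentzForm {V : Type*} [AddCommGroup V] [Module ℝ V]
    (B : LinearMap.BilinForm ℝ V) : Prop :=
  B.IsSymm ∧ ∃ (n : ℕ) (e : Module.Basis (Fin (n + 1)) ℝ V), ∀ i j,
    B (e i) (e j) = if i = j then (if i = 0 then -1 else 1) else 0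

/-- `|v|₁ = √|⟨v, v⟩₁|`. -/
noncomputable def formAbs {V : Type*} [AddCommGroup V] [Module ℝ V]
    (B : LinearMap.BilinForm ℝ V) (v : V) : ℝ :=
  Real.sqrt |B v v|

/-- The cone `𝔗` of future causal vectors, for the time orientation represented by the
timelike vector `τ`: a causal vector is future pointing iff its product with `τ` is negative. -/
def futureCone {V : Type*} [AddCommGroup V] [Module ℝ V]
    (B : LinearMap.BilinForm ℝ V) (τ : V) : Set V :=
  {v | v ≠ 0 ∧ B v v ≤ 0 ∧ B τ v < 0}

/-- The subcone `𝔗_ε` of those `v ∈ 𝔗` with `dist (v, ∂𝔗) ≥ ε ‖v‖`. -/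
noncomputable def futureSubcone {V : Type*} [NormedAddCommGroup V] [NormedSpace ℝ V]
    (B : LinearMap.BilinForm ℝ V) (τ : V) (ε : ℝ) : Set V :=
  {v | v ∈ futureCone B τ ∧ ε * ‖v‖ ≤ Metric.infDist v (frontier (futureCone B τ))}

/-- The conformally flat Lorentzian metric `f² ⟨·, ·⟩₁`, at the point `x`. -/
noncomputable def conformalMetric {V : Type*} [AddCommGroup V] [Module ℝ V]
    (B : LinearMap.BilinForm ℝ V) (f : V → ℝ) (x : V) : LinearMap.BilinForm ℝ V :=
  (f x) ^ 2 • B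

/-- `γ` restricted to `[a, b]` (where `a < b`) is a piecewise smooth future pointing causal
curve: for some partition `a = t₀ < ⋯ < tₙ = b` it is smooth on every closed piece
`[tᵢ, tᵢ₊₁]`, with (one-sided, at the ends of the piece) velocity in `𝔗` throughout. -/
def IsFutureCausalCurve {V : Type*} [NormedAddCommGroup V] [NormedSpace ℝ V]
    (B : LinearMap.BilinForm ℝ V) (τ : V) (γ : ℝ → V) (a b : ℝ) : Prop :=
  a < b ∧ ∃ (n : ℕ) (t : ℕ → ℝ), t 0 = a ∧ t n = b ∧ ∀ i < n,
    t i < t (i + 1) ∧ ContDiffOn ℝ ∞ γ (Icc (t i) (t (i + 1))) ∧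
    ∀ s ∈ Icc (t i) (t (i + 1)), derivWithin γ (Icc (t i) (t (i + 1))) s ∈ futureCone B τ

/-- Lorentzian arclength of `γ` on `[a, b]` for the metric `f² ⟨·, ·⟩₁`. The finitely many
break points of a piecewise smooth curve do not matter for the integral. -/
noncomputable def lorentzLength {V : Type*} [NormedAddCommGroup V] [NormedSpace ℝ V]
    (B : LinearMap.BilinForm ℝ V) (f : V → ℝ) (γ : ℝ → V) (a b : ℝ) : ℝ :=
  ∫ s in a..b, Real.sqrt |conformalMetric B f (γ s) (deriv γ s) (deriv γ s)|

/-- The time separation (Lorentzian distance) of `(V, f² ⟨·, ·⟩₁)`, with values in `[0, ∞]`: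
the supremum of the lengths of the future pointing causal curves from `x` to `y`, and `0` if
there are none. -/
noncomputable def timeSeparation {V : Type*} [NormedAddCommGroup V] [NormedSpace ℝ V]
    (B : LinearMap.BilinForm ℝ V) (τ : V) (f : V → ℝ) (x y : V) : ENNReal :=
  sSup {L | ∃ (γ : ℝ → V) (a b : ℝ), IsFutureCausalCurve B τ γ a b ∧ γ a = x ∧ γ b = y ∧
    L = ENNReal.ofReal (lorentzLength B f γ a b)}

/-! Write D for the time separation. Since D is invariant under the lattice and τ is interior to the
causal cone, base points can be exchanged at the price of a bounded shift: D(p, p+u) ≤ D(x, x+u+sτ)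
(`IsPeriodicSeparation.exists_shift`). Hence g(u) = inf_p D(p, p+u) is superadditive on the closed
cone and g(u) ≤ D(p, p+u) ≤ g(u+sτ). Fekete's lemma yields l(u) = lim g(tu)/t, which is homogeneous,
superadditive, therefore concave, and at least g.

The substance is a converse bound l(u) ≤ g(u+r'τ) + 1 with r' independent of u. It follows by
iterating the approximate halving g(u) ≤ 1 + 2g(u/2+rτ) (`IsShiftProfile.exists_halving`). Take an
almost longest curve from 0 to u, broken into short steps. A discrete Hobby–Rice theorem
(`exists_balanced_cut`) cuts it in at most dim V places so that the odd pieces, and likewise the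
even ones, have total displacement u/2 up to a bounded error. Each piece may be moved elsewhere at
the cost of one shift sτ, so by superadditivity the pieces of each parity contribute at most
g(u/2+rτ). The number of pieces does not depend on u, so neither does r.

The Hobby–Rice theorem is proved by a count mod 2 instead of Borsuk–Ulam. Sign patterns with few
changes form a complex of faces of a cube; for generic vectors the number of k-faces meeting the
first k equations is odd for every k up to the dimension (`faceParity_eq_one`).

Together these give l(v-rτ) - 1 ≤ D(x, x+v) ≤ l(v+sτ), with r now the shift in the converse bound.
Away from the boundary of the cone, concavity and homogeneity make l vary boundedly under bounded
shifts along τ; this is where ε enters (`IsStableSeparation.exists_abs_sub_le`). -/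

/-! ### Linear subspaces meeting faces of a cube -/

/-- A coordinate with u i ≠ 0 reaches the sign of u i at time (|u i| - x i u i) / (u i)^2; the ray
leaves the cube at the smallest of these times. The sign condition records that the crossing is
outward. -/
theorem exists_cube_exit {ι : Type*} [Fintype ι] {x u : ι → ℝ} (hx : ∀ i, |x i| ≤ 1)
    (hu : u ≠ 0) : ∃ t : ℝ, 0 ≤ t ∧ (∀ i, |x i + t * u i| ≤ 1) ∧
      ∃ i, 0 < u i * (x i + t * u i) ∧ |x i + t * u i| = 1 := by
  classical
  obtain ⟨i₀, hi₀⟩ := Function.ne_iff.1 hu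
  have hne : (Finset.univ.filter fun i => u i ≠ 0).Nonempty := ⟨i₀, by simpa using hi₀⟩
  obtain ⟨i, hi, hmin⟩ := Finset.exists_min_image _ (fun i => (|u i| - x i * u i) / (u i) ^ 2) hne
  have hr : ∀ j, u j ≠ 0 → 0 ≤ (|u j| - x j * u j) / (u j) ^ 2 := by
    intro j _
    have : x j * u j ≤ |u j| := by
      calc x j * u j ≤ |x j * u j| := le_abs_self _
        _ = |x j| * |u j| := abs_mul _ _
        _ ≤ 1 * |u j| := by gcongr; exact hx j
        _ = |u j| := one_mul _
    have := sub_nonneg.2 this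
    positivity
  have hval : ∀ j, u j ≠ 0 → (|u j| - x j * u j) / (u j) ^ 2 * u j = |u j| / u j - x j := by
    intro j hj
    field_simp
  have hi' : u i ≠ 0 := by simpa using hi
  refine ⟨(|u i| - x i * u i) / (u i) ^ 2, hr i hi', fun j => ?_, i, ?_, ?_⟩
  · by_cases hj : u j = 0
    · simpa [hj] using hx j
    have h1 := hmin j (by simpa using hj)
    have h2 := hval j hj
    have h0 := hr i hi'
    have hxj := abs_le.1 (hx j)
    rw [abs_le]
    rcases lt_or_gt_of_ne hj with h | h
    · rw [abs_of_neg h, neg_div, div_self hj] at h2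
      have h3 := mul_le_mul_of_nonpos_right h1 h.le
      have h4 := mul_nonpos_of_nonneg_of_nonpos h0 h.le
      simp only [abs_of_neg h] at h2 h3
      constructor <;> linarith
    · rw [abs_of_pos h, div_self hj] at h2
      have h3 := mul_le_mul_of_nonneg_right h1 h.le
      have h4 := mul_nonneg h0 h.le
      simp only [abs_of_pos h] at h2 h3
      constructor <;> linarith
  · rw [hval i hi']
    have : u i * (x i + (|u i| / u i - x i)) = |u i| := by field_simp; ring
    rw [this]; exact abs_pos.2 hi'
  · rw [hval i hi']
    have : x i + (|u i| / u i - x i) = |u i| / u i := by ring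
    rw [this, abs_div, abs_abs, div_self (abs_pos.2 hi').ne']

/-- By `h1`, `K` meets the face only away from its faces of codimension two. The intersection is
then one-dimensional, since from an endpoint on the facet of p one could otherwise move with
coordinate p fixed until a second facet is hit. So it is a segment whose ends lie on distinct
facets. -/
theorem exists_endpoints {ι : Type*} [Fintype ι] {S : Finset ι}
    {K : Submodule ℝ (ι → ℝ)}
    (hK : ∃ u ∈ K, u ≠ 0 ∧ ∀ j ∉ S, u j = 0)
    (h1 : ∀ x ∈ K, (∀ j, |x j| ≤ 1) → (∀ j ∉ S, |x j| = 1) →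
      ∀ s ∈ S, ∀ s' ∈ S, |x s| = 1 → |x s'| = 1 → s = s')
    {x : ι → ℝ} (hxK : x ∈ K) (hx : ∀ j, |x j| ≤ 1) (hxS : ∀ j ∉ S, |x j| = 1) :
    ∃ P ∈ K, ∃ Q ∈ K, (∀ j, |P j| ≤ 1) ∧ (∀ j, |Q j| ≤ 1) ∧
      (∀ j ∉ S, P j = x j) ∧ (∀ j ∉ S, Q j = x j) ∧
      ∃ p ∈ S, ∃ q ∈ S, |P p| = 1 ∧ |Q q| = 1 ∧ (p = q → P p ≠ Q q) ∧
      ∀ y ∈ K, (∀ j, |y j| ≤ 1) → (∀ j ∉ S, y j = x j) →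
        ∃ θ : ℝ, 0 ≤ θ ∧ θ ≤ 1 ∧ y = P + θ • (Q - P) := by
  obtain ⟨u, huK, hu, huS⟩ := hK
  obtain ⟨t, ht, htc, p, hp, hp1⟩ := exists_cube_exit hx hu
  obtain ⟨t', ht', htc', q, hq, hq1⟩ := exists_cube_exit hx (neg_ne_zero.2 hu)
  have hpS : p ∈ S := by
    by_contra h
    simp [huS p h] at hp
  have hqS : q ∈ S := by
    by_contra h
    simp [huS q h] at hq
  set P : ι → ℝ := x + t • u with hP
  set Q : ι → ℝ := x + t' • (-u) with hQ
  have hPK : P ∈ K := K.add_mem hxK (K.smul_mem _ huK)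
  have hQK : Q ∈ K := K.add_mem hxK (K.smul_mem _ (K.neg_mem huK))
  have hPj : ∀ j, P j = x j + t * u j := fun j => by simp [hP]
  have hQj : ∀ j, Q j = x j + t' * (-u) j := fun j => by simp [hQ]
  have hPS : ∀ j ∉ S, P j = x j := fun j hj => by rw [hPj, huS j hj]; ring
  have hQS : ∀ j ∉ S, Q j = x j := fun j hj => by rw [hQj, Pi.neg_apply, huS j hj]; ring
  simp only [← hPj] at htc hp hp1
  simp only [← hQj] at htc' hq hq1
  have hP1 : ∀ j ∉ S, |P j| = 1 := fun j hj => by rw [hPS j hj]; exact hxS j hj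
  have hQ1 : ∀ j ∉ S, |Q j| = 1 := fun j hj => by rw [hQS j hj]; exact hxS j hj
  have hpq : p = q → P p ≠ Q q := by
    rintro rfl h
    rw [h] at hp
    simp only [Pi.neg_apply] at hq
    linarith
  -- If P = Q, then p = q by `h1`, whereas the exits along u and -u through one coordinate are on
  -- opposite sides.
  have htt : 0 < t + t' := by
    by_contra hcon
    have h0 : t = 0 := by linarith
    have h0' : t' = 0 := by linarith
    have hPQ : P = Q := by rw [hP, hQ, h0, h0']; simp
    have := h1 P hPK htc hP1 p hpS q hqS hp1 (by rw [hPQ]; exact hq1)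
    exact hpq this (by rw [hPQ, this])
  refine ⟨P, hPK, Q, hQK, htc, htc', hPS, hQS, p, hpS, q, hqS, hp1, hq1, hpq, ?_⟩
  intro y hyK hy hyS
  have hup : u p ≠ 0 := by
    rintro h
    simp [h] at hp
  -- `w` is the component of `y - P` leaving coordinate `p` fixed
  set w : ι → ℝ := (y - P) - ((y p - P p) / u p) • u with hw
  have hwK : w ∈ K := K.sub_mem (K.sub_mem hyK hPK) (K.smul_mem _ huK)
  have hwS : ∀ j ∉ S, w j = 0 := fun j hj => by simp [hw, huS j hj, hyS j hj, hPS j hj]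
  have hwp : w p = 0 := by simp [hw]; field_simp; ring
  have hw0 : w = 0 := by
    by_contra hne
    obtain ⟨r, -, hr, s, hs, hs1⟩ := exists_cube_exit htc hne
    have hsS : s ∈ S := by
      by_contra h
      simp [hwS s h] at hs
    have := h1 (P + r • w) (K.add_mem hPK (K.smul_mem _ hwK)) (by simpa using hr)
      (fun j hj => by simpa [hwS j hj] using hP1 j hj) s hsS p hpS (by simpa using hs1)
      (by simpa [hwp] using hp1)
    rw [this, hwp] at hs
    simp at hs
  set c := (y p - P p) / u p with hc
  have hy' : ∀ j, y j = P j + c * u j := fun j => by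
    have := congrFun hw0 j
    simp [hw] at this
    linarith
  have hsub : Q - P = (-(t + t')) • u := by
    ext j; simp only [Pi.sub_apply, hPj, hQj, Pi.neg_apply, Pi.smul_apply, smul_eq_mul]; ring
  have hyp := hy p
  have hyq := hy q
  rw [hy' p] at hyp
  rw [hy' q] at hyq
  have hcneg : c ≤ 0 := by
    by_contra hcon
    push Not at hcon
    rcases abs_eq (zero_le_one) |>.1 hp1 with h | h
    · rw [h] at hp hyp
      have := mul_pos hcon (by linarith : 0 < u p)
      have := (abs_le.1 hyp).2
      linarith
    · rw [h] at hp hyp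
      have := mul_pos hcon (by linarith : 0 < - u p)
      have := (abs_le.1 hyp).1
      linarith
  have hcge : -(t + t') ≤ c := by
    by_contra hcon
    push Not at hcon
    have e : P q + c * u q = Q q + (-(c + (t + t'))) * (-u q) := by
      rw [hPj, hQj, Pi.neg_apply]; ring
    rw [e] at hyq
    simp only [Pi.neg_apply] at hq
    have hpos : 0 < -(c + (t + t')) := by linarith
    rcases abs_eq (zero_le_one) |>.1 hq1 with h | h
    · rw [h] at hq hyq
      have := mul_pos hpos (by linarith : 0 < - u q)
      have := (abs_le.1 hyq).2
      linarith
    · rw [h] at hq hyq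
      have := mul_pos hpos (by linarith : 0 < u q)
      have := (abs_le.1 hyq).1
      linarith
  refine ⟨-c / (t + t'), by apply div_nonneg <;> linarith, by rw [div_le_one htt]; linarith, ?_⟩
  ext j
  rw [hsub, hy' j]
  simp only [Pi.add_apply, Pi.smul_apply, smul_eq_mul]
  field_simp

-- A segment with ends off the hyperplane φ = 0 crosses it exactly when an odd number of its ends
-- have φ > 0. The ends lie on distinct facets and no interior point lies on a facet, so that number
-- is the number of facets carrying a point with φ > 0.
open Classical in
theorem parity_of_faces {ι : Type*} [Fintype ι] {S : Finset ι} (σ : ι → ℝ)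
    (hσ : ∀ j, |σ j| = 1) {K : Submodule ℝ (ι → ℝ)} (φ : (ι → ℝ) →ₗ[ℝ] ℝ)
    (hK : ∃ u ∈ K, u ≠ 0 ∧ ∀ j ∉ S, u j = 0)
    (h1 : ∀ x ∈ K, (∀ j, |x j| ≤ 1) → (∀ j ∉ S, |x j| = 1) →
      ∀ s ∈ S, ∀ s' ∈ S, |x s| = 1 → |x s'| = 1 → s = s')
    (h2 : ∀ x ∈ K, (∀ j, |x j| ≤ 1) → (∀ j ∉ S, |x j| = 1) →
      ∀ s ∈ S, |x s| = 1 → φ x ≠ 0) :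
    (if ∃ x ∈ K, (∀ j, |x j| ≤ 1) ∧ (∀ j ∉ S, x j = σ j) ∧ φ x = 0 then (1 : ZMod 2) else 0) =
      ∑ s ∈ S, ((if ∃ x ∈ K, (∀ j, |x j| ≤ 1) ∧ (∀ j ∉ S, x j = σ j) ∧ x s = 1 ∧ 0 < φ x
          then (1 : ZMod 2) else 0) +
        (if ∃ x ∈ K, (∀ j, |x j| ≤ 1) ∧ (∀ j ∉ S, x j = σ j) ∧ x s = -1 ∧ 0 < φ x
          then (1 : ZMod 2) else 0)) := by
  by_cases hne : ∃ x ∈ K, (∀ j, |x j| ≤ 1) ∧ (∀ j ∉ S, x j = σ j)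
  swap
  · push Not at hne
    rw [if_neg, Finset.sum_eq_zero]
    · intro s _
      rw [if_neg, if_neg, add_zero]
      · rintro ⟨x, hx, hc, hs, -⟩
        obtain ⟨j, hj, hj'⟩ := hne x hx hc
        exact hj' (hs j hj)
      · rintro ⟨x, hx, hc, hs, -⟩
        obtain ⟨j, hj, hj'⟩ := hne x hx hc
        exact hj' (hs j hj)
    · rintro ⟨x, hx, hc, hs, -⟩
      obtain ⟨j, hj, hj'⟩ := hne x hx hc
      exact hj' (hs j hj)
  obtain ⟨x, hxK, hx, hxS⟩ := hne
  obtain ⟨P, hP, Q, hQ, hPc, hQc, hPS, hQS, p, hp, q, hq, hp1, hq1, hpq, hseg⟩ :=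
    exists_endpoints hK h1 hxK hx (fun j hj => by rw [hxS j hj, hσ])
  have hPσ : ∀ j ∉ S, P j = σ j := fun j hj => (hPS j hj).trans (hxS j hj)
  have hQσ : ∀ j ∉ S, Q j = σ j := fun j hj => (hQS j hj).trans (hxS j hj)
  have hP1 : ∀ j ∉ S, |P j| = 1 := fun j hj => by rw [hPσ j hj, hσ]
  have hQ1 : ∀ j ∉ S, |Q j| = 1 := fun j hj => by rw [hQσ j hj, hσ]
  have hφP := h2 P hP hPc hP1 p hp hp1
  have hφQ := h2 Q hQ hQc hQ1 q hq hq1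
  have hface : ∀ s ∈ S, ∀ ε : ℝ, |ε| = 1 →
      ((∃ x ∈ K, (∀ j, |x j| ≤ 1) ∧ (∀ j ∉ S, x j = σ j) ∧ x s = ε ∧ 0 < φ x) ↔
        ((s, ε) = (p, P p) ∧ 0 < φ P) ∨ ((s, ε) = (q, Q q) ∧ 0 < φ Q)) := by
    intro s hs ε hε
    constructor
    · rintro ⟨y, hyK, hy, hyS, hys, hφy⟩
      obtain ⟨θ, hθ0, hθ1, rfl⟩ := hseg y hyK hy (fun j hj => by rw [hyS j hj, hxS j hj])
      rcases hθ0.eq_or_lt with rfl | hθ0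
      · simp only [zero_smul, add_zero] at hys hφy
        left
        have : s = p := h1 P hP hPc hP1 s hs p hp (by rw [hys, hε]) hp1
        subst this
        exact ⟨by rw [hys], hφy⟩
      rcases hθ1.eq_or_lt with rfl | hθ1
      · simp only [one_smul, add_sub_cancel] at hys hφy
        right
        have : s = q := h1 Q hQ hQc hQ1 s hs q hq (by rw [hys, hε]) hq1
        subst this
        exact ⟨by rw [hys], hφy⟩
      exfalso
      have hPs := abs_le.1 (hPc s)
      have hQs := abs_le.1 (hQc s)
      simp only [Pi.add_apply, Pi.smul_apply, Pi.sub_apply, smul_eq_mul] at hys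
      have : P s = ε ∧ Q s = ε := by
        rcases abs_eq zero_le_one |>.1 hε with h | h <;> rw [h] at hys ⊢ <;>
          constructor <;> nlinarith
      have e1 : s = p := h1 P hP hPc hP1 s hs p hp (by rw [this.1, hε]) hp1
      have e2 : s = q := h1 Q hQ hQc hQ1 s hs q hq (by rw [this.2, hε]) hq1
      subst e1
      exact hpq e2 (by rw [← e2, this.1, this.2])
    · rintro (⟨h, h'⟩ | ⟨h, h'⟩)
      · simp only [Prod.mk.injEq] at h
        obtain ⟨rfl, rfl⟩ := h
        exact ⟨P, hP, hPc, hPσ, rfl, h'⟩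
      · simp only [Prod.mk.injEq] at h
        obtain ⟨rfl, rfl⟩ := h
        exact ⟨Q, hQ, hQc, hQσ, rfl, h'⟩
  have hne' : (p, P p) ≠ (q, Q q) := by
    simp only [ne_eq, Prod.mk.injEq, not_and]
    exact hpq
  have hmem : ∀ ε : ℝ, |ε| = 1 → ε ∈ ({1, -1} : Finset ℝ) := fun ε h => by
    simpa using abs_eq zero_le_one |>.1 h
  have hind : ∀ z ∈ S ×ˢ ({1, -1} : Finset ℝ),
      (if ∃ x ∈ K, (∀ j, |x j| ≤ 1) ∧ (∀ j ∉ S, x j = σ j) ∧ x z.1 = z.2 ∧ 0 < φ x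
          then (1 : ZMod 2) else 0) =
        (if z = (p, P p) then (if 0 < φ P then (1 : ZMod 2) else 0) else 0) +
        (if z = (q, Q q) then (if 0 < φ Q then (1 : ZMod 2) else 0) else 0) := by
    rintro ⟨s, ε⟩ hz
    simp only [Finset.mem_product, Finset.mem_insert, Finset.mem_singleton] at hz
    have hε : |ε| = 1 := abs_eq zero_le_one |>.2 hz.2
    rw [if_congr (hface s hz.1 ε hε) rfl rfl]
    by_cases ha : (s, ε) = (p, P p)
    · have hb : (s, ε) ≠ (q, Q q) := fun h => hne' (ha.symm.trans h)
      simp [ha, hne']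
    · simp [ha, ite_and]
  have hsum : ∑ s ∈ S, ((if ∃ x ∈ K, (∀ j, |x j| ≤ 1) ∧ (∀ j ∉ S, x j = σ j) ∧ x s = 1 ∧ 0 < φ x
          then (1 : ZMod 2) else 0) +
        (if ∃ x ∈ K, (∀ j, |x j| ≤ 1) ∧ (∀ j ∉ S, x j = σ j) ∧ x s = -1 ∧ 0 < φ x
          then (1 : ZMod 2) else 0)) =
      (if 0 < φ P then (1 : ZMod 2) else 0) + (if 0 < φ Q then (1 : ZMod 2) else 0) := by
    trans ∑ z ∈ S ×ˢ ({1, -1} : Finset ℝ),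
      (if ∃ x ∈ K, (∀ j, |x j| ≤ 1) ∧ (∀ j ∉ S, x j = σ j) ∧ x z.1 = z.2 ∧ 0 < φ x
          then (1 : ZMod 2) else 0)
    · rw [Finset.sum_product]
      refine Finset.sum_congr rfl fun s _ => ?_
      rw [Finset.sum_pair (by norm_num)]
    · rw [Finset.sum_congr rfl hind, Finset.sum_add_distrib, Finset.sum_ite_eq',
        Finset.sum_ite_eq', if_pos (Finset.mk_mem_product hp (hmem _ hp1)),
        if_pos (Finset.mk_mem_product hq (hmem _ hq1))]
  rw [hsum]
  have hval : ∀ θ : ℝ, φ (P + θ • (Q - P)) = (1 - θ) * φ P + θ * φ Q := fun θ => by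
    simp only [map_add, map_smul, map_sub, smul_eq_mul]; ring
  have hiff : (∃ x ∈ K, (∀ j, |x j| ≤ 1) ∧ (∀ j ∉ S, x j = σ j) ∧ φ x = 0) ↔
      φ P * φ Q < 0 := by
    constructor
    · rintro ⟨y, hyK, hy, hyS, hφy⟩
      obtain ⟨θ, hθ0, hθ1, rfl⟩ := hseg y hyK hy (fun j hj => by rw [hyS j hj, hxS j hj])
      rw [hval] at hφy
      by_contra hcon
      push Not at hcon
      have hpos : 0 < φ P * φ Q := lt_of_le_of_ne hcon (mul_ne_zero hφP hφQ).symm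
      have h3 : 0 < φ P * φ P := mul_self_pos.2 hφP
      have h4 : (1 - θ) * (φ P * φ P) + θ * (φ P * φ Q) = 0 := by linear_combination φ P * hφy
      rcases hθ0.eq_or_lt with rfl | h
      · linarith
      · nlinarith [mul_pos h hpos, mul_nonneg (sub_nonneg.2 hθ1) h3.le]
    · intro h
      have hd : φ P - φ Q ≠ 0 := by
        intro h0
        have : φ P = φ Q := by linarith
        rw [this] at h
        nlinarith [mul_self_nonneg (φ Q)]
      have hθ : 0 ≤ φ P / (φ P - φ Q) ∧ φ P / (φ P - φ Q) ≤ 1 := by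
        rcases lt_or_gt_of_ne hφP with h' | h'
        · have : 0 < φ Q := by nlinarith
          rw [← neg_div_neg_eq]
          constructor
          · apply div_nonneg <;> linarith
          · rw [div_le_one] <;> linarith
        · have : φ Q < 0 := by nlinarith
          constructor
          · apply div_nonneg <;> linarith
          · rw [div_le_one] <;> linarith
      set θ := φ P / (φ P - φ Q) with hθdef
      refine ⟨P + θ • (Q - P), K.add_mem hP (K.smul_mem _ (K.sub_mem hQ hP)), fun j => ?_,
        fun j hj => ?_, ?_⟩
      · have ha := abs_le.1 (hPc j)
        have hb := abs_le.1 (hQc j)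
        simp only [Pi.add_apply, Pi.smul_apply, Pi.sub_apply, smul_eq_mul]
        rw [abs_le]
        constructor <;> nlinarith
      · simp [hPσ j hj, hQσ j hj]
      · rw [hval, hθdef]
        field_simp
        ring
  rw [if_congr hiff rfl rfl]
  rcases lt_or_gt_of_ne hφP with h | h <;> rcases lt_or_gt_of_ne hφQ with h' | h'
  · rw [if_neg (by nlinarith), if_neg h.le.not_gt, if_neg h'.le.not_gt, add_zero]
  · rw [if_pos (by nlinarith), if_neg h.le.not_gt, if_pos h', zero_add]
  · rw [if_pos (by nlinarith), if_pos h, if_neg h'.le.not_gt, add_zero]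
  · rw [if_neg (by nlinarith), if_pos h, if_pos h']
    rfl

/-! ### Alternating sign patterns and the parity count -/

/-- The sign pattern which starts with `+` and changes sign after each element of `S`. -/
noncomputable def cutSign {N : ℕ} (S : Finset (Fin N)) (j : Fin N) : ℝ :=
  (-1) ^ (S.filter (· < j)).card

theorem cutSign_eq {N : ℕ} (S : Finset (Fin N)) (j : Fin N) : cutSign S j = 1 ∨ cutSign S j = -1 :=
  neg_one_pow_eq_or ℝ _

theorem abs_cutSign {N : ℕ} (S : Finset (Fin N)) (j : Fin N) : |cutSign S j| = 1 :=
  (abs_eq zero_le_one).2 (cutSign_eq S j)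

theorem cutSign_insert {N : ℕ} {S : Finset (Fin N)} {s : Fin N} (hs : s ∉ S) (j : Fin N) :
    cutSign (insert s S) j = cutSign S j * if s < j then -1 else 1 := by
  unfold cutSign
  rw [Finset.filter_insert]
  split_ifs
  · rw [Finset.card_insert_of_notMem (by simp [hs]), pow_succ]
  · simp

/-- The solutions of the first `k` of the linear equations with columns `a j`. -/
def firstEqs {N d : ℕ} (a : Fin N → Fin d → ℝ) (k : ℕ) : Submodule ℝ (Fin N → ℝ) where
  carrier := {x | ∀ i : Fin d, (i : ℕ) < k → ∑ j, x j * a j i = 0}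
  add_mem' {x y} hx hy i hi := by
    simp only [Pi.add_apply, add_mul, Finset.sum_add_distrib, hx i hi, hy i hi, add_zero]
  zero_mem' i _ := by simp
  smul_mem' c x hx i hi := by
    simp only [Pi.smul_apply, smul_eq_mul, mul_assoc, ← Finset.mul_sum, hx i hi, mul_zero]

/-- General position: a face of the cube of dimension `k < d` has no solution of the first `k + 1`
equations. -/
def GenPos {N d : ℕ} (a : Fin N → Fin d → ℝ) : Prop :=
  ∀ S : Finset (Fin N), S.card < d → ∀ x : Fin N → ℝ, (∀ j, |x j| ≤ 1) → (∀ j ∉ S, |x j| = 1) →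
    ∃ i : Fin d, (i : ℕ) ≤ S.card ∧ ∑ j, x j * a j i ≠ 0

theorem exists_supported_solution {N d k : ℕ} (a : Fin N → Fin d → ℝ) (S : Finset (Fin N))
    (hS : S.card = k + 1) : ∃ u ∈ firstEqs a k, u ≠ 0 ∧ ∀ j ∉ S, u j = 0 := by
  classical
  let L : (S → ℝ) →ₗ[ℝ] (Fin k → ℝ) :=
    -- Indices beyond the d available equations give the trivial equation 0 = 0; k equations in k +
    -- 1 unknowns have a nonzero solution.
    { toFun := fun y i => if h : (i : ℕ) < d then ∑ s : S, y s * a s ⟨i, h⟩ else 0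
      map_add' := fun y z => by
        ext i
        by_cases h : (i : ℕ) < d <;> simp [h, add_mul, Finset.sum_add_distrib]
      map_smul' := fun c y => by
        ext i
        by_cases h : (i : ℕ) < d <;> simp [h, mul_assoc, Finset.mul_sum] }
  have hker : LinearMap.ker L ≠ ⊥ := LinearMap.ker_ne_bot_of_finrank_lt (by simp [hS])
  obtain ⟨y, hy, hy0⟩ := (Submodule.ne_bot_iff _).1 hker
  refine ⟨fun j => if h : j ∈ S then y ⟨j, h⟩ else 0, fun i hi => ?_, fun h0 => hy0 ?_,
    fun j hj => by simp [hj]⟩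
  · have := congrFun (LinearMap.mem_ker.1 hy) ⟨i, hi⟩
    simp only [L, LinearMap.coe_mk, AddHom.coe_mk, Fin.is_lt, dif_pos, Pi.zero_apply] at this
    rw [← Finset.sum_subset (Finset.subset_univ S) fun j _ hj => by simp [hj],
      ← Finset.sum_coe_sort S, ← this]
    exact Finset.sum_congr rfl fun s _ => by simp
  · ext s
    have := congrFun h0 s
    simpa using this

/-- Double counting of incident pairs of a face and a facet direction, indexed by the larger or by
the smaller free set. -/
theorem sum_powersetCard_succ {α M : Type*} [Fintype α] [DecidableEq α] [AddCommMonoid M]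
    (k : ℕ) (F : Finset α → α → M) :
    ∑ S ∈ Finset.powersetCard (k + 1) Finset.univ, ∑ s ∈ S, F (S.erase s) s =
      ∑ S ∈ Finset.powersetCard k (Finset.univ : Finset α), ∑ s ∈ Sᶜ, F S s := by
  rw [Finset.sum_sigma', Finset.sum_sigma']
  refine Finset.sum_bij' (fun z _ => ⟨z.1.erase z.2, z.2⟩) (fun z _ => ⟨insert z.2 z.1, z.2⟩)
    ?_ ?_ ?_ ?_ ?_
  · rintro ⟨S, s⟩ h
    simp only [Finset.mem_sigma, Finset.mem_powersetCard, Finset.subset_univ, true_and,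
      Finset.mem_compl] at h ⊢
    exact ⟨by rw [Finset.card_erase_of_mem h.2, h.1]; rfl, by simp⟩
  · rintro ⟨S, s⟩ h
    simp only [Finset.mem_sigma, Finset.mem_powersetCard, Finset.subset_univ, true_and,
      Finset.mem_compl] at h ⊢
    exact ⟨by rw [Finset.card_insert_of_notMem h.2, h.1], by simp⟩
  · rintro ⟨S, s⟩ h
    simp only [Finset.mem_sigma] at h
    simp [Finset.insert_erase h.2]
  · rintro ⟨S, s⟩ h
    simp only [Finset.mem_sigma, Finset.mem_compl] at h
    simp [Finset.erase_insert h.2]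
  · rintro ⟨S, s⟩ _
    rfl

theorem sum_telescope_zmod_two {N : ℕ} (h : ℕ → ZMod 2) :
    ∑ s : Fin N, (h s + h (s + 1)) = h 0 + h N := by
  rw [Fin.sum_univ_eq_sum_range (fun i => h i + h (i + 1)) N]
  induction N with
  | zero => simp [CharTwo.add_self_eq_zero]
  | succ n ih =>
    rw [Finset.sum_range_succ, ih]
    linear_combination CharTwo.add_self_eq_zero (h n)

open Classical in
/-- Parity, in `ZMod 2`, of the number of faces with `k` free coordinates of the complex of
alternating sign patterns which meet the solutions of the first `k` equations. -/
noncomputable def faceParity {N d : ℕ} (a : Fin N → Fin d → ℝ) (k : ℕ) : ZMod 2 :=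
  ∑ S ∈ Finset.powersetCard k Finset.univ,
    if ∃ x ∈ firstEqs a k, (∀ j, |x j| ≤ 1) ∧ ∀ j ∉ S, x j = cutSign S j then 1 else 0

open Classical in
/-- Indicator of the event that the face with pattern `± cutSign S`, switched at `c`, contains a
point of `K` with `φ > 0`. -/
noncomputable def switchedFace {N : ℕ} (K : Submodule ℝ (Fin N → ℝ)) (φ : (Fin N → ℝ) →ₗ[ℝ] ℝ)
    (S : Finset (Fin N)) (c : ℕ) : ZMod 2 :=
  if ∃ x ∈ K, (∀ j, |x j| ≤ 1) ∧
    (∀ j ∉ S, x j = cutSign S j * if (j : ℕ) < c then 1 else -1) ∧ 0 < φ x then 1 else 0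

-- With T = S.erase s, the pattern of S off s is that of T reversed beyond s. Fixing coordinate s
-- therefore amounts to reversing the pattern of T from s on or from s + 1 on; the sign of `cutSign
-- T s` decides only which of the two facets is which.
open Classical in
theorem switchedFace_add {N : ℕ} (K : Submodule ℝ (Fin N → ℝ)) (φ : (Fin N → ℝ) →ₗ[ℝ] ℝ)
    {S : Finset (Fin N)} {s : Fin N} (hs : s ∈ S) :
    ((if ∃ x ∈ K, (∀ j, |x j| ≤ 1) ∧ (∀ j ∉ S, x j = cutSign S j) ∧ x s = 1 ∧ 0 < φ x
          then (1 : ZMod 2) else 0) +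
        (if ∃ x ∈ K, (∀ j, |x j| ≤ 1) ∧ (∀ j ∉ S, x j = cutSign S j) ∧ x s = -1 ∧ 0 < φ x
          then (1 : ZMod 2) else 0)) =
      switchedFace K φ (S.erase s) s + switchedFace K φ (S.erase s) (s + 1) := by
  obtain ⟨T, hT, rfl⟩ : ∃ T, s ∉ T ∧ S = insert s T :=
    ⟨S.erase s, by simp, (Finset.insert_erase hs).symm⟩
  rw [Finset.erase_insert hT]
  have key : ∀ (x : Fin N → ℝ) (c : ℕ) (ε : ℝ), (c = s ∧ ε = -1) ∨ (c = s + 1 ∧ ε = 1) →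
      ((∀ j ∉ T, x j = cutSign T j * if (j : ℕ) < c then 1 else -1) ↔
        (∀ j ∉ insert s T, x j = cutSign (insert s T) j) ∧ x s = ε * cutSign T s) := by
    intro x c ε hc
    have hlt : ∀ j : Fin N, j ≠ s → ((j : ℕ) < c ↔ ¬ s < j) := by
      intro j hj
      have : (j : ℕ) ≠ s := fun h => hj (Fin.ext h)
      rw [Fin.lt_def]
      omega
    have hs' : (if (s : ℕ) < c then (1 : ℝ) else -1) = ε := by
      rcases hc with ⟨rfl, rfl⟩ | ⟨rfl, rfl⟩ <;> simp
    constructor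
    · intro h
      refine ⟨fun j hj => ?_, ?_⟩
      · simp only [Finset.mem_insert, not_or] at hj
        rw [h j hj.2, cutSign_insert hT, if_congr (hlt j hj.1) rfl rfl, ite_not]
      · rw [h s hT, hs', mul_comm]
    · rintro ⟨h, hss⟩ j hj
      by_cases hjs : j = s
      · subst hjs
        rw [hss, hs', mul_comm]
      · rw [h j (by simp [hj, hjs]), cutSign_insert hT, if_congr (hlt j hjs) rfl rfl, ite_not]
  have e1 : switchedFace K φ T s = if ∃ x ∈ K, (∀ j, |x j| ≤ 1) ∧
      (∀ j ∉ insert s T, x j = cutSign (insert s T) j) ∧ x s = -cutSign T s ∧ 0 < φ x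
      then 1 else 0 := by
    unfold switchedFace
    simp only [key _ _ _ (Or.inl ⟨rfl, rfl⟩), neg_mul, one_mul, and_assoc]
  have e2 : switchedFace K φ T (s + 1) = if ∃ x ∈ K, (∀ j, |x j| ≤ 1) ∧
      (∀ j ∉ insert s T, x j = cutSign (insert s T) j) ∧ x s = cutSign T s ∧ 0 < φ x
      then 1 else 0 := by
    unfold switchedFace
    simp only [key _ _ _ (Or.inr ⟨rfl, rfl⟩), one_mul, and_assoc]
  rw [e1, e2]
  rcases cutSign_eq T s with h | h <;> simp only [h, neg_neg]
  rw [add_comm]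

/-- Apply `parity_of_faces` to every (k+1)-face and regroup by facets. Over a fixed T the reversed
patterns telescope in the switching place, leaving the pattern of T and its antipode. Points of the
antipode with φ > 0 are negatives of points of T with φ < 0. On the solutions in the face T, φ has
no zero by general position, hence one sign by convexity, so the two remaining terms count whether T
meets the first k equations. -/
theorem faceParity_succ {N d k : ℕ} {a : Fin N → Fin d → ℝ} (ha : GenPos a) (hk : k < d) :
    faceParity a (k + 1) = faceParity a k := by
  classical
  let φ : (Fin N → ℝ) →ₗ[ℝ] ℝ :=
    { toFun := fun x => ∑ j, x j * a j ⟨k, hk⟩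
      map_add' := fun x y => by simp [add_mul, Finset.sum_add_distrib]
      map_smul' := fun c x => by simp [mul_assoc, Finset.mul_sum] }
  have hφ : ∀ S : Finset (Fin N), S.card = k → ∀ x ∈ firstEqs a k, (∀ j, |x j| ≤ 1) →
      (∀ j ∉ S, |x j| = 1) → φ x ≠ 0 := by
    intro S hS x hx hxc hxS
    obtain ⟨i, hi, hne⟩ := ha S (by omega) x hxc hxS
    rcases lt_or_eq_of_le hi with h | h
    · exact absurd (hx i (by omega)) hne
    · have : i = ⟨k, hk⟩ := Fin.ext (by simp [h, hS])
      rw [this] at hne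
      exact hne
  have hmem : ∀ x, x ∈ firstEqs a (k + 1) ↔ x ∈ firstEqs a k ∧ φ x = 0 := by
    intro x
    constructor
    · intro h
      exact ⟨fun i hi => h i (by omega), h ⟨k, hk⟩ (by simp)⟩
    · rintro ⟨h, h'⟩ i hi
      rcases Nat.lt_succ_iff_lt_or_eq.1 hi with h1 | h1
      · exact h i h1
      · have : i = ⟨k, hk⟩ := Fin.ext h1
        rw [this]
        exact h'
  have step : ∀ S ∈ Finset.powersetCard (k + 1) (Finset.univ : Finset (Fin N)),
      (if ∃ x ∈ firstEqs a (k + 1), (∀ j, |x j| ≤ 1) ∧ ∀ j ∉ S, x j = cutSign S j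
        then (1 : ZMod 2) else 0) =
      ∑ s ∈ S, (switchedFace (firstEqs a k) φ (S.erase s) s +
        switchedFace (firstEqs a k) φ (S.erase s) (s + 1)) := by
    intro S hS
    replace hS : S.card = k + 1 := (Finset.mem_powersetCard.1 hS).2
    rw [← Finset.sum_congr rfl fun s hs => switchedFace_add (firstEqs a k) φ hs,
      ← parity_of_faces (cutSign S) (abs_cutSign S) φ (exists_supported_solution a S hS)]
    · refine if_congr ?_ rfl rfl
      simp only [hmem]
      constructor
      · rintro ⟨x, ⟨h1, h2⟩, h3, h4⟩
        exact ⟨x, h1, h3, h4, h2⟩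
      · rintro ⟨x, h1, h3, h4, h2⟩
        exact ⟨x, ⟨h1, h2⟩, h3, h4⟩
    · intro x hx hxc hxS s hs s' hs' h h'
      by_contra hne
      have hcard : ((S.erase s).erase s').card + 1 = k := by
        have h1 := Finset.card_erase_of_mem hs
        have h2 := Finset.card_erase_of_mem (Finset.mem_erase.2 ⟨Ne.symm hne, hs'⟩)
        have h3 := Finset.card_pos.2 ⟨s', Finset.mem_erase.2 ⟨Ne.symm hne, hs'⟩⟩
        omega
      obtain ⟨i, hi, hne'⟩ := ha ((S.erase s).erase s') (by omega) x hxc (by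
        intro j hj
        simp only [Finset.mem_erase, not_and] at hj
        by_cases h1 : j = s'
        · rw [h1, h']
        by_cases h2 : j = s
        · rw [h2, h]
        exact hxS j (hj h1 h2))
      exact hne' (hx i (by omega))
    · intro x hx hxc hxS s hs h
      refine hφ (S.erase s) (by rw [Finset.card_erase_of_mem hs, hS]; rfl) x hx hxc ?_
      intro j hj
      simp only [Finset.mem_erase, not_and] at hj
      by_cases h2 : j = s
      · rw [h2, h]
      exact hxS j (hj h2)
  unfold faceParity
  rw [Finset.sum_congr rfl step, sum_powersetCard_succ k (fun S s =>
    switchedFace (firstEqs a k) φ S s + switchedFace (firstEqs a k) φ S (s + 1))]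
  refine Finset.sum_congr rfl fun S hS => ?_
  replace hS : S.card = k := (Finset.mem_powersetCard.1 hS).2
  -- Coordinate s ∈ S is free, so switching at s or at s + 1 imposes the same conditions. These
  -- pairs cancel mod 2 and may be added to complete the telescoping sum.
  have hzero : ∀ s ∈ Finset.univ, s ∉ Sᶜ → switchedFace (firstEqs a k) φ S s +
      switchedFace (firstEqs a k) φ S (s + 1) = 0 := by
    intro s _ hs
    have hs : s ∈ S := by simpa using hs
    have : switchedFace (firstEqs a k) φ S s = switchedFace (firstEqs a k) φ S (s + 1) := by
      unfold switchedFace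
      refine if_congr (exists_congr fun x => and_congr_right fun _ => and_congr_right fun _ =>
        and_congr_left fun _ => forall₂_congr fun j hj => ?_) rfl rfl
      have hjs : (j : ℕ) ≠ s := fun h => hj (by rw [Fin.ext h]; exact hs)
      rw [if_congr (show (j : ℕ) < s ↔ (j : ℕ) < s + 1 by omega) rfl rfl]
    rw [this, CharTwo.add_self_eq_zero]
  rw [Finset.sum_subset (Finset.subset_univ _) hzero, sum_telescope_zmod_two]
  have hab : ∀ x : Fin N → ℝ, (∀ j ∉ S, x j = cutSign S j) → ∀ j ∉ S, |x j| = 1 :=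
    fun x h j hj => by rw [h j hj, abs_cutSign]
  have h0 : switchedFace (firstEqs a k) φ S 0 = if ∃ x ∈ firstEqs a k, (∀ j, |x j| ≤ 1) ∧
      (∀ j ∉ S, x j = cutSign S j) ∧ φ x < 0 then 1 else 0 := by
    unfold switchedFace
    refine if_congr ⟨?_, ?_⟩ rfl rfl
    · rintro ⟨x, hx, hxc, hxS, hx0⟩
      refine ⟨-x, neg_mem hx, by simpa using hxc, fun j hj => ?_, by simpa using hx0⟩
      simp [hxS j hj]
    · rintro ⟨x, hx, hxc, hxS, hx0⟩
      refine ⟨-x, neg_mem hx, by simpa using hxc, fun j hj => ?_, by simpa using hx0⟩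
      simp [hxS j hj]
  have hN : switchedFace (firstEqs a k) φ S N = if ∃ x ∈ firstEqs a k, (∀ j, |x j| ≤ 1) ∧
      (∀ j ∉ S, x j = cutSign S j) ∧ 0 < φ x then 1 else 0 := by
    unfold switchedFace
    simp
  rw [h0, hN]
  have hexcl : ¬ ((∃ x ∈ firstEqs a k, (∀ j, |x j| ≤ 1) ∧
      (∀ j ∉ S, x j = cutSign S j) ∧ φ x < 0) ∧ ∃ x ∈ firstEqs a k, (∀ j, |x j| ≤ 1) ∧
      (∀ j ∉ S, x j = cutSign S j) ∧ 0 < φ x) := by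
    rintro ⟨⟨x, hx, hxc, hxS, hx0⟩, ⟨y, hy, hyc, hyS, hy0⟩⟩
    have hd : 0 < φ y - φ x := by linarith
    have hθ0 : 0 ≤ φ y / (φ y - φ x) := by apply div_nonneg <;> linarith
    have hθ1 : 0 ≤ -φ x / (φ y - φ x) := by apply div_nonneg <;> linarith
    have hθ : φ y / (φ y - φ x) + -φ x / (φ y - φ x) = 1 := by field_simp; ring
    refine hφ S hS ((φ y / (φ y - φ x)) • x + (-φ x / (φ y - φ x)) • y)
      (add_mem (Submodule.smul_mem _ _ hx) (Submodule.smul_mem _ _ hy)) (fun j => ?_)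
      (hab _ fun j hj => ?_) ?_
    · have h1 := abs_le.1 (hxc j)
      have h2 := abs_le.1 (hyc j)
      simp only [Pi.add_apply, Pi.smul_apply, smul_eq_mul]
      rw [abs_le]
      constructor <;> nlinarith
    · simp only [Pi.add_apply, Pi.smul_apply, smul_eq_mul, hxS j hj, hyS j hj, ← add_mul, hθ,
        one_mul]
    · simp only [map_add, map_smul, smul_eq_mul]
      field_simp
      ring
  by_cases hneg : ∃ x ∈ firstEqs a k, (∀ j, |x j| ≤ 1) ∧ (∀ j ∉ S, x j = cutSign S j) ∧ φ x < 0
  · rw [if_pos hneg, if_neg fun h => hexcl ⟨hneg, h⟩, if_pos, add_zero]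
    obtain ⟨x, hx, hxc, hxS, -⟩ := hneg
    exact ⟨x, hx, hxc, hxS⟩
  · rw [if_neg hneg, zero_add]
    refine if_congr ⟨?_, ?_⟩ rfl rfl
    · rintro ⟨x, hx, hxc, hxS, -⟩
      exact ⟨x, hx, hxc, hxS⟩
    · rintro ⟨x, hx, hxc, hxS⟩
      refine ⟨x, hx, hxc, hxS, ?_⟩
      rcases lt_or_gt_of_ne (hφ S hS x hx hxc (hab x hxS)) with h | h
      · exact absurd ⟨x, hx, hxc, hxS, h⟩ hneg
      · exact h

theorem faceParity_eq_one {N d : ℕ} {a : Fin N → Fin d → ℝ} (ha : GenPos a) :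
    ∀ k ≤ d, faceParity a k = 1
  | 0, _ => by
    unfold faceParity
    rw [Finset.powersetCard_zero, Finset.sum_singleton, if_pos]
    exact ⟨fun _ => 1, fun i hi => absurd hi (by omega), by simp, by simp [cutSign]⟩
  | k + 1, hk => by rw [faceParity_succ ha (by omega), faceParity_eq_one ha k (by omega)]

theorem GenPos.exists_cut {N d : ℕ} {a : Fin N → Fin d → ℝ} (ha : GenPos a) :
    ∃ S : Finset (Fin N), S.card = d ∧ ∃ x : Fin N → ℝ, (∀ j, |x j| ≤ 1) ∧
      (∀ j ∉ S, x j = cutSign S j) ∧ ∀ i, ∑ j, x j * a j i = 0 := by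
  classical
  have h := faceParity_eq_one ha d le_rfl
  by_contra! hcon
  refine zero_ne_one ((Finset.sum_eq_zero fun S hS => ?_).symm.trans h)
  rw [if_neg]
  rintro ⟨x, hx, hxc, hxS⟩
  obtain ⟨i, hi⟩ := hcon S (Finset.mem_powersetCard.1 hS).2 x hxc hxS
  exact hi (hx i i.2)

/-! ### Generic configurations and the discrete Hobby–Rice theorem -/

/-- The configurations for which the face with free coordinates `S` and signs `σ` violates general
position. -/
def degenerateFace {N : ℕ} (d : ℕ) (S : Finset (Fin N)) (σ : Fin N → ℤˣ) :
    Set (Fin N → Fin d → ℝ) :=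
  {a | ∃ x : Fin N → Icc (-1 : ℝ) 1, (∀ j ∉ S, (x j : ℝ) = ((σ j : ℤ) : ℝ)) ∧
    ∀ i : Fin d, (i : ℕ) ≤ S.card → ∑ j, (x j : ℝ) * a j i = 0}

theorem isClosed_degenerateFace {N : ℕ} (d : ℕ) (S : Finset (Fin N)) (σ : Fin N → ℤˣ) :
    IsClosed (degenerateFace d S σ) := by
  have h : IsClosed {p : (Fin N → Icc (-1 : ℝ) 1) × (Fin N → Fin d → ℝ) |
      (∀ j ∉ S, (p.1 j : ℝ) = ((σ j : ℤ) : ℝ)) ∧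
        ∀ i : Fin d, (i : ℕ) ≤ S.card → ∑ j, (p.1 j : ℝ) * p.2 j i = 0} := by
    simp only [ofPred_and, ofPred_forall]
    refine IsClosed.inter (isClosed_iInter fun j => isClosed_iInter fun _ => ?_)
      (isClosed_iInter fun i => isClosed_iInter fun _ => ?_)
    · exact isClosed_eq (by fun_prop) continuous_const
    · exact isClosed_eq (by fun_prop) continuous_const
  convert isClosedMap_snd_of_compactSpace _ h using 1
  ext a
  simp [degenerateFace]

/-- The |S| free columns, truncated to |S| + 1 equations, miss some direction w. Perturb a column
outside S, whose coefficient is a fixed sign, along w. If two different perturbations were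
degenerate, the difference of their solutions would express a nonzero multiple of w by the free
columns. -/
theorem dense_compl_degenerateFace {N d : ℕ} (hd : d ≤ N) {S : Finset (Fin N)} (hS : S.card < d)
    (σ : Fin N → ℤˣ) : Dense (degenerateFace d S σ)ᶜ := by
  classical
  rw [Metric.dense_iff]
  intro a r hr
  obtain ⟨j₀, hj₀⟩ : ∃ j, j ∉ S := by
    by_contra! h
    have := Finset.card_le_card (fun j _ => h j : (Finset.univ : Finset (Fin N)) ⊆ S)
    simp at this
    omega
  let L : (S → ℝ) →ₗ[ℝ] (Fin (S.card + 1) → ℝ) :=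
    { toFun := fun y i => ∑ s : S, y s * a s ⟨i, by omega⟩
      map_add' := fun y z => by
        ext i
        simp [add_mul, Finset.sum_add_distrib]
      map_smul' := fun c y => by
        ext i
        simp [mul_assoc, Finset.mul_sum] }
  obtain ⟨w, hw⟩ : ∃ w, w ∉ LinearMap.range L := by
    by_contra! h
    have h1 := LinearMap.finrank_range_le L
    rw [(eq_top_iff.2 fun w _ => h w : LinearMap.range L = ⊤), finrank_top] at h1
    simp at h1
  let v : Fin d → ℝ := fun i => if h : (i : ℕ) < S.card + 1 then w ⟨i, h⟩ else 0
  have hdist : ∀ δ : ℝ, |δ| * (‖v‖ + 1) < r → a + Pi.single j₀ (δ • v) ∈ Metric.ball a r := by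
    intro δ hδ
    rw [Metric.mem_ball, dist_eq_norm, add_sub_cancel_left]
    refine lt_of_le_of_lt ?_ hδ
    rw [pi_norm_le_iff_of_nonneg (by positivity)]
    intro j
    rcases eq_or_ne j j₀ with rfl | h
    · rw [Pi.single_eq_same, norm_smul, Real.norm_eq_abs]
      gcongr
      linarith
    · rw [Pi.single_eq_of_ne h]
      simp only [norm_zero]
      positivity
  have hsum : ∀ (δ : ℝ) (x : Fin N → ℝ) (i : Fin d), ∑ j, x j * (a + Pi.single j₀ (δ • v) : Fin N → Fin d → ℝ) j i =
      ∑ j, x j * a j i + x j₀ * (δ * v i) := by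
    intro δ x i
    simp only [Pi.add_apply, mul_add, Finset.sum_add_distrib, add_right_inj]
    rw [Finset.sum_eq_single j₀]
    · simp
    · intro j _ hj
      simp [Pi.single_eq_of_ne hj]
    · simp
  set c := ‖v‖ + 1 with hc
  have hcpos : 0 < c := by positivity
  have hball : ∀ θ : ℝ, 0 < θ → θ < 1 →
      a + Pi.single j₀ ((θ * r / c) • v) ∈ Metric.ball a r := by
    intro θ h0 h1
    apply hdist
    rw [abs_of_pos (by positivity), div_mul_cancel₀ _ hcpos.ne']
    nlinarith
  by_contra hcon
  have hbad : ∀ θ : ℝ, 0 < θ → θ < 1 →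
      a + Pi.single j₀ ((θ * r / c) • v) ∈ degenerateFace d S σ := by
    intro θ h0 h1
    by_contra h
    exact hcon ⟨_, hball θ h0 h1, h⟩
  obtain ⟨x, hx, hxi⟩ := hbad (1 / 2) (by norm_num) (by norm_num)
  obtain ⟨y, hy, hyi⟩ := hbad (1 / 4) (by norm_num) (by norm_num)
  have hne : ((σ j₀ : ℤ) : ℝ) * (r / (4 * c)) ≠ 0 := by
    have h1 : ((σ j₀ : ℤ) : ℝ) ≠ 0 := by simp
    have h2 : r / (4 * c) ≠ 0 := by positivity
    exact mul_ne_zero h1 h2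
  apply hw
  have : (((σ j₀ : ℤ) : ℝ) * (r / (4 * c))) • w ∈ LinearMap.range L := by
    refine ⟨fun s => (y s : ℝ) - x s, ?_⟩
    ext i
    have h1 := hxi ⟨i, by omega⟩ (by simp; omega)
    have h2 := hyi ⟨i, by omega⟩ (by simp; omega)
    rw [hsum _ (fun j => (x j : ℝ)), hx j₀ hj₀] at h1
    rw [hsum _ (fun j => (y j : ℝ)), hy j₀ hj₀] at h2
    have hv : v ⟨i, by omega⟩ = w i := dif_pos i.2
    rw [hv] at h1 h2
    have h3 : ∑ j, ((y j : ℝ) - x j) * a j ⟨i, by omega⟩ =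
        ((σ j₀ : ℤ) : ℝ) * (r / (4 * c)) * w i := by
      simp only [sub_mul, Finset.sum_sub_distrib]
      have e : r / (4 * c) = 1 / 2 * r / c - 1 / 4 * r / c := by field_simp; norm_num
      rw [e]
      linarith
    simp only [L, LinearMap.coe_mk, AddHom.coe_mk, Pi.smul_apply, smul_eq_mul]
    rw [← h3, ← Finset.sum_subset (Finset.subset_univ S) fun j _ hj => by
      simp [hx j hj, hy j hj], ← Finset.sum_coe_sort S]
  have h := (LinearMap.range L).smul_mem (((σ j₀ : ℤ) : ℝ) * (r / (4 * c)))⁻¹ this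
  rwa [smul_smul, inv_mul_cancel₀ hne, one_smul] at h

theorem dense_genPos {N d : ℕ} (hd : d ≤ N) : Dense {a : Fin N → Fin d → ℝ | GenPos a} := by
  classical
  have : Dense (⋂ z : {S : Finset (Fin N) // S.card < d} × (Fin N → ℤˣ),
      (degenerateFace d z.1.1 z.2)ᶜ) :=
    dense_iInter_of_isOpen (fun z => (isClosed_degenerateFace d _ _).isOpen_compl)
      (fun z => dense_compl_degenerateFace hd z.1.2 _)
  refine this.mono fun a ha S hS x hx hxS => ?_
  by_contra! hcon
  refine mem_iInter.1 ha (⟨S, hS⟩, fun j => if x j = 1 then 1 else -1)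
    ⟨fun j => ⟨x j, abs_le.1 (hx j)⟩, fun j hj => ?_, hcon⟩
  rcases (abs_eq zero_le_one).1 (hxS j hj) with h | h
  · simp [h]
  · simp only [h]
    norm_num

/-- A discrete Hobby–Rice theorem: a chain of bounded vectors can be cut in at most `dim V` places
such that the alternating sum of the resulting pieces is bounded. -/
theorem exists_balanced_cut (V : Type*) [NormedAddCommGroup V] [NormedSpace ℝ V]
    [FiniteDimensional ℝ V] : ∃ C : ℝ, 0 ≤ C ∧ ∀ (N : ℕ) (u : Fin N → V), (∀ j, ‖u j‖ ≤ 1) →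
      ∃ S : Finset (Fin N), S.card ≤ Module.finrank ℝ V ∧ ‖∑ j, cutSign S j • u j‖ ≤ C := by
  classical
  set d := Module.finrank ℝ V with hd
  let φ : V ≃L[ℝ] (Fin d → ℝ) := (Module.finBasis ℝ V).equivFunL
  set A := ‖(φ : V →L[ℝ] (Fin d → ℝ))‖
  set A' := ‖(φ.symm : (Fin d → ℝ) →L[ℝ] V)‖
  -- The term d settles N < d. Otherwise 2dA is the cost of replacing x by signs on the d free
  -- coordinates, 1 bounds the total effect of perturbing N vectors by at most 1/(N+1), and A'
  -- transfers the estimate back to `V`.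
  refine ⟨d + A' * (2 * d * A + 1), by positivity, fun N u hu => ?_⟩
  rcases lt_or_ge N d with hN | hN
  · refine ⟨∅, by simp, ?_⟩
    calc ‖∑ j, cutSign ∅ j • u j‖ ≤ ∑ j : Fin N, (1 : ℝ) := norm_sum_le_of_le _ fun j _ => by
          rw [norm_smul, Real.norm_eq_abs, abs_cutSign, one_mul]
          exact hu j
      _ = N := by simp
      _ ≤ d := by exact_mod_cast hN.le
      _ ≤ _ := by
        have : 0 ≤ A' * (2 * d * A + 1) := by positivity
        linarith
  obtain ⟨a, ha, hdist⟩ := (dense_genPos hN).exists_dist_lt (fun j => φ (u j))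
    (show (0 : ℝ) < 1 / (N + 1) by positivity)
  obtain ⟨S, hS, x, hx, hxS, h0⟩ := GenPos.exists_cut ha
  refine ⟨S, hS.le, ?_⟩
  have h0' : ∑ j, x j • a j = 0 := by
    ext i
    simpa using h0 i
  have hφu : ∀ j, ‖φ (u j)‖ ≤ A := fun j => by
    calc ‖φ (u j)‖ ≤ A * ‖u j‖ := (φ : V →L[ℝ] (Fin d → ℝ)).le_opNorm _
      _ ≤ A * 1 := by gcongr; exact hu j
      _ = A := mul_one _
  have hsplit : φ (∑ j, cutSign S j • u j) =
      ∑ j ∈ S, (cutSign S j - x j) • φ (u j) + ∑ j, x j • (φ (u j) - a j) := by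
    rw [Finset.sum_subset (Finset.subset_univ S) fun j _ hj => by rw [hxS j hj]; simp]
    simp only [smul_sub, sub_smul, Finset.sum_sub_distrib, h0', map_sum, map_smul]
    abel
  have h1 : ‖∑ j ∈ S, (cutSign S j - x j) • φ (u j)‖ ≤ 2 * d * A := by
    calc _ ≤ ∑ j ∈ S, 2 * A := norm_sum_le_of_le _ fun j _ => by
          rw [norm_smul]
          gcongr
          · calc ‖cutSign S j - x j‖ ≤ ‖cutSign S j‖ + ‖x j‖ := norm_sub_le _ _
              _ ≤ 1 + 1 := by
                gcongr
                · exact (abs_cutSign S j).le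
                · exact hx j
              _ = 2 := by norm_num
          · exact hφu j
      _ = 2 * d * A := by rw [Finset.sum_const, hS]; simp; ring
  have h2 : ‖∑ j, x j • (φ (u j) - a j)‖ ≤ 1 := by
    calc _ ≤ ∑ j : Fin N, 1 * (1 / ((N : ℝ) + 1)) := norm_sum_le_of_le _ fun j _ => by
          rw [norm_smul]
          gcongr
          · exact hx j
          · rw [← dist_eq_norm]
            exact (dist_le_pi_dist (fun j => φ (u j)) a j).trans hdist.le
      _ = N / (N + 1) := by simp; field_simp
      _ ≤ 1 := by rw [div_le_one] <;> linarith [(Nat.cast_nonneg N : (0 : ℝ) ≤ N)]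
  calc ‖∑ j, cutSign S j • u j‖ = ‖φ.symm (φ (∑ j, cutSign S j • u j))‖ := by simp
    _ ≤ A' * ‖φ (∑ j, cutSign S j • u j)‖ :=
      (φ.symm : (Fin d → ℝ) →L[ℝ] V).le_opNorm _
    _ ≤ A' * (2 * d * A + 1) := by
      gcongr
      rw [hsplit]
      exact (norm_add_le _ _).trans (add_le_add h1 h2)
    _ ≤ _ := by
      have : (0 : ℝ) ≤ d := by positivity
      linarith

/-! ### Algebra and topology of the causal cone -/

section Cone

variable {V : Type*} [AddCommGroup V] [Module ℝ V] {B : LinearMap.BilinForm ℝ V} {τ : V}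

/-- In pseudo-orthonormal coordinates let a, b be the time components of p, v and P, Q the squared
lengths of their spatial parts. Orthogonality and Cauchy–Schwarz give a²b² ≤ PQ, while P < a²; so b²
< Q unless v = 0. -/
theorem IsLorentzForm.pos_of_orthogonal (hB : IsLorentzForm B) {p : V} (hp : B p p < 0) {v : V}
    (hpv : B p v = 0) (hv : v ≠ 0) : 0 < B v v := by
  obtain ⟨-, n, e, he⟩ := hB
  have hval : ∀ x y : V, B x y =
      -(e.repr x 0 * e.repr y 0) + ∑ i : Fin n, e.repr x i.succ * e.repr y i.succ := by
    intro x y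
    conv_lhs => rw [← e.sum_repr x, ← e.sum_repr y]
    simp only [map_sum, map_smul, LinearMap.sum_apply, LinearMap.smul_apply, smul_eq_mul, he]
    rw [Fin.sum_univ_succ]
    simp [Fin.succ_ne_zero, mul_comm]
  rw [hval] at hp hpv ⊢
  set a := e.repr p 0
  set b := e.repr v 0
  set P := ∑ i : Fin n, e.repr p i.succ * e.repr p i.succ with hP
  set Q := ∑ i : Fin n, e.repr v i.succ * e.repr v i.succ with hQ
  set R := ∑ i : Fin n, e.repr p i.succ * e.repr v i.succ
  have hcs : R ^ 2 ≤ P * Q := by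
    have := Finset.sum_mul_sq_le_sq_mul_sq Finset.univ (fun i : Fin n => e.repr p i.succ)
      (fun i : Fin n => e.repr v i.succ)
    simpa only [sq, hP, hQ] using this
  have hP0 : 0 ≤ P := Finset.sum_nonneg fun i _ => mul_self_nonneg _
  have hQ0 : 0 ≤ Q := Finset.sum_nonneg fun i _ => mul_self_nonneg _
  have hR : R = a * b := by linarith
  have ha : 0 < a * a := by linarith
  rcases hQ0.eq_or_lt with h | h
  · exfalso
    have hb : b = 0 := by
      rw [← h, hR] at hcs
      have : (a * a) * (b * b) ≤ 0 := by nlinarith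
      by_contra hb
      have := mul_pos ha (mul_self_pos.2 hb)
      linarith
    have hz : ∀ i : Fin n, e.repr v i.succ = 0 := fun i => by
      have := (Finset.sum_eq_zero_iff_of_nonneg fun i _ => mul_self_nonneg _).1 h.symm i
        (Finset.mem_univ _)
      exact mul_self_eq_zero.1 this
    apply hv
    apply e.repr.map_eq_zero_iff.1
    ext i
    refine Fin.cases ?_ (fun i => ?_) i
    · exact hb
    · exact hz i
  · rw [hR] at hcs
    by_contra hcon
    have h1 : Q ≤ b * b := by linarith
    have h2 : (a * a) * (b * b) ≤ P * Q := by nlinarith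
    nlinarith [mul_nonneg hP0 (sub_nonneg.2 h1), mul_pos ha h]

theorem IsLorentzForm.symm (hB : IsLorentzForm B) (v w : V) : B v w = B w v :=
  LinearMap.BilinForm.IsSymm.eq hB.1 v w

/-- The future cone together with the zero vector. -/
def closedFutureCone (B : LinearMap.BilinForm ℝ V) (τ : V) : Set V :=
  {v | B v v ≤ 0 ∧ B τ v ≤ 0}

theorem IsLorentzForm.eq_zero_of_mem (hB : IsLorentzForm B) (hτ : B τ τ < 0) {v : V}
    (hv : B v v ≤ 0) (h : B τ v = 0) : v = 0 := by
  by_contra hne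
  exact absurd (hB.pos_of_orthogonal hτ h hne) (not_lt.2 hv)

theorem mem_futureCone_iff (hB : IsLorentzForm B) (hτ : B τ τ < 0) {v : V} :
    v ∈ futureCone B τ ↔ v ∈ closedFutureCone B τ ∧ v ≠ 0 := by
  constructor
  · rintro ⟨h1, h2, h3⟩
    exact ⟨⟨h2, h3.le⟩, h1⟩
  · rintro ⟨⟨h1, h2⟩, h3⟩
    exact ⟨h3, h1, lt_of_le_of_ne h2 fun h => h3 (hB.eq_zero_of_mem hτ h1 h)⟩

theorem futureCone_subset : futureCone B τ ⊆ closedFutureCone B τ := fun _ h => ⟨h.2.1, h.2.2.le⟩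

theorem zero_mem_closedFutureCone : (0 : V) ∈ closedFutureCone B τ := by
  simp [closedFutureCone]

theorem smul_mem_closedFutureCone {c : ℝ} (hc : 0 ≤ c) {v : V} (hv : v ∈ closedFutureCone B τ) :
    c • v ∈ closedFutureCone B τ := by
  refine ⟨?_, ?_⟩
  · simp only [map_smul, LinearMap.smul_apply, smul_eq_mul]
    exact mul_nonpos_of_nonneg_of_nonpos hc (mul_nonpos_of_nonneg_of_nonpos hc hv.1)
  · simp only [map_smul, smul_eq_mul]
    exact mul_nonpos_of_nonneg_of_nonpos hc hv.2

/-- The combination of v and w orthogonal to τ has nonnegative square; expanding it bounds the mixed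
term by the two nonpositive squares. -/
theorem form_nonpos_of_mem (hB : IsLorentzForm B) (hτ : B τ τ < 0) {v w : V}
    (hv : v ∈ closedFutureCone B τ) (hw : w ∈ closedFutureCone B τ) : B v w ≤ 0 := by
  by_cases hv0 : v = 0
  · simp [hv0]
  by_cases hw0 : w = 0
  · simp [hw0]
  have hv' := ((mem_futureCone_iff hB hτ).2 ⟨hv, hv0⟩).2.2
  have hw' := ((mem_futureCone_iff hB hτ).2 ⟨hw, hw0⟩).2.2
  have hx : 0 ≤ B (B τ w • v - B τ v • w) (B τ w • v - B τ v • w) := by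
    by_cases h0 : B τ w • v - B τ v • w = 0
    · simp [h0]
    · exact (hB.pos_of_orthogonal hτ (by simp [mul_comm]) h0).le
  simp only [map_sub, map_smul, LinearMap.sub_apply, LinearMap.smul_apply, smul_eq_mul,
    hB.symm w v] at hx
  have h1 := mul_pos_of_neg_of_neg hv' hw'
  by_contra hcon
  push Not at hcon
  nlinarith [mul_pos h1 hcon, mul_nonneg (mul_self_nonneg (B τ w)) (neg_nonneg.2 hv.1),
    mul_nonneg (mul_self_nonneg (B τ v)) (neg_nonneg.2 hw.1)]

theorem add_mem_closedFutureCone (hB : IsLorentzForm B) (hτ : B τ τ < 0) {v w : V}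
    (hv : v ∈ closedFutureCone B τ) (hw : w ∈ closedFutureCone B τ) :
    v + w ∈ closedFutureCone B τ := by
  have h := form_nonpos_of_mem hB hτ hv hw
  refine ⟨?_, ?_⟩
  · simp only [map_add, LinearMap.add_apply, hB.symm w v]
    linarith [hv.1, hw.1]
  · simp only [map_add]
    linarith [hv.2, hw.2]

theorem smul_mem_futureCone {c : ℝ} (hc : 0 < c) {v : V} (hv : v ∈ futureCone B τ) :
    c • v ∈ futureCone B τ := by
  refine ⟨smul_ne_zero hc.ne' hv.1, (smul_mem_closedFutureCone hc.le (futureCone_subset hv)).1, ?_⟩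
  simp only [map_smul, smul_eq_mul]
  exact mul_neg_of_pos_of_neg hc hv.2.2

theorem add_mem_futureCone (hB : IsLorentzForm B) (hτ : B τ τ < 0) {v w : V}
    (hv : v ∈ futureCone B τ) (hw : w ∈ closedFutureCone B τ) : v + w ∈ futureCone B τ := by
  have h : B τ (v + w) < 0 := by
    simp only [map_add]
    linarith [hv.2.2, hw.2]
  refine ⟨?_, (add_mem_closedFutureCone hB hτ (futureCone_subset hv) hw).1, h⟩
  rintro h0
  simp [h0] at h

theorem mem_futureCone_self (hτ : B τ τ < 0) : τ ∈ futureCone B τ :=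
  ⟨by rintro rfl; simp at hτ, hτ.le, hτ⟩

theorem convex_closedFutureCone (hB : IsLorentzForm B) (hτ : B τ τ < 0) :
    Convex ℝ (closedFutureCone B τ) := fun _ hx _ hy _ _ ha hb _ =>
  add_mem_closedFutureCone hB hτ (smul_mem_closedFutureCone ha hx) (smul_mem_closedFutureCone hb hy)

theorem convex_futureCone (hB : IsLorentzForm B) (hτ : B τ τ < 0) :
    Convex ℝ (futureCone B τ) := by
  intro x hx y hy a b ha hb hab
  rcases ha.eq_or_lt with rfl | ha
  · rw [zero_add] at hab
    simpa [hab] using hy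
  · exact add_mem_futureCone hB hτ (smul_mem_futureCone ha hx)
      (smul_mem_closedFutureCone hb (futureCone_subset hy))

theorem formAbs_of_mem {v : V} (hv : v ∈ closedFutureCone B τ) :
    formAbs B v = Real.sqrt (-B v v) := by
  rw [formAbs, abs_of_nonpos hv.1]

theorem formAbs_nonneg (v : V) : 0 ≤ formAbs B v := Real.sqrt_nonneg _

theorem formAbs_smul (c : ℝ) (v : V) : formAbs B (c • v) = |c| * formAbs B v := by
  simp only [formAbs, map_smul, LinearMap.smul_apply, smul_eq_mul, ← mul_assoc, abs_mul]
  rw [Real.sqrt_mul (by positivity), Real.sqrt_mul_self (abs_nonneg _)]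

/-- The reverse Cauchy–Schwarz inequality. -/
theorem formAbs_mul_le (hB : IsLorentzForm B) (hτ : B τ τ < 0) {p v : V}
    (hp : p ∈ closedFutureCone B τ) (hpp : B p p < 0) (hv : v ∈ closedFutureCone B τ) :
    formAbs B p * formAbs B v ≤ -B p v := by
  rw [formAbs_of_mem hp, formAbs_of_mem hv, ← Real.sqrt_mul (by linarith)]
  refine Real.sqrt_le_iff.2 ⟨by linarith [form_nonpos_of_mem hB hτ hp hv], ?_⟩
  -- This is a multiple of the component of v orthogonal to p, on which the form is positive.
  have hx : 0 ≤ B (B p p • v - B p v • p) (B p p • v - B p v • p) := by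
    by_cases h0 : B p p • v - B p v • p = 0
    · simp [h0]
    · exact (hB.pos_of_orthogonal hpp (by simp [mul_comm]) h0).le
  simp only [map_sub, map_smul, LinearMap.sub_apply, LinearMap.smul_apply, smul_eq_mul,
    hB.symm v p] at hx
  have h2 : 0 ≤ B p p * (B p p * B v v - B p v * B p v) := by linarith
  by_contra hcon
  have h3 : 0 < B p p * B v v - B p v * B p v := by nlinarith
  nlinarith [mul_neg_of_neg_of_pos hpp h3]

end Cone

section NormedCone

variable {V : Type*} [NormedAddCommGroup V] [NormedSpace ℝ V] [FiniteDimensional ℝ V]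
  {B : LinearMap.BilinForm ℝ V} {τ : V}

theorem continuous_form : Continuous fun p : V × V => B p.1 p.2 := by
  have h : ∀ p : V × V, B p.1 p.2 =
      (LinearMap.toContinuousLinearMap
        ((LinearMap.toContinuousLinearMap (𝕜 := ℝ) (E := V) (F' := ℝ)).toLinearMap ∘ₗ B)) p.1 p.2 :=
    fun p => rfl
  simp only [h]
  fun_prop

theorem Continuous.form {X : Type*} [TopologicalSpace X] {g h : X → V} (hg : Continuous g)
    (hh : Continuous h) : Continuous fun x => B (g x) (h x) :=
  continuous_form.comp (hg.prodMk hh)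

theorem isClosed_closedFutureCone : IsClosed (closedFutureCone B τ) :=
  (isClosed_le (continuous_id.form continuous_id) continuous_const).inter
    (isClosed_le (continuous_const.form continuous_id) continuous_const)

theorem continuous_formAbs : Continuous (formAbs B) :=
  Real.continuous_sqrt.comp (continuous_abs.comp (continuous_id.form continuous_id))

theorem exists_formAbs_le (B : LinearMap.BilinForm ℝ V) :
    ∃ C : ℝ, 0 < C ∧ ∀ v, formAbs B v ≤ C * ‖v‖ := by
  obtain ⟨C, hC⟩ := (isCompact_sphere (0 : V) 1).bddAbove_image
    (continuous_formAbs (B := B)).continuousOn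
  refine ⟨max C 1, by positivity, fun v => ?_⟩
  by_cases hv : v = 0
  · simp [hv, formAbs]
  have hn : 0 < ‖v‖ := norm_pos_iff.2 hv
  have h1 : formAbs B (‖v‖⁻¹ • v) ≤ C := hC ⟨_, by simp [norm_smul, hn.ne'], rfl⟩
  rw [formAbs_smul, abs_of_pos (by positivity), inv_mul_le_iff₀ hn] at h1
  calc formAbs B v ≤ ‖v‖ * C := h1
    _ ≤ max C 1 * ‖v‖ := by rw [mul_comm]; gcongr; exact le_max_left _ _

/-- Timelike future vectors are interior to the cone, in a homogeneous form. -/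
theorem exists_add_smul_mem {p : V} (hpp : B p p < 0) (hp : B τ p < 0) :
    ∃ κ : ℝ, 0 < κ ∧ ∀ v : V, ∀ s : ℝ, κ * ‖v‖ ≤ s → s • p + v ∈ closedFutureCone B τ := by
  have ho : IsOpen {v | B v v < 0 ∧ B τ v < 0} :=
    (isOpen_lt (continuous_id.form continuous_id) continuous_const).inter
      (isOpen_lt (continuous_const.form continuous_id) continuous_const)
  obtain ⟨r, hr, hball⟩ := Metric.isOpen_iff.1 ho p ⟨hpp, hp⟩
  refine ⟨2 / r, by positivity, fun v s hs => ?_⟩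
  by_cases hv : v = 0
  · have hs0 : 0 ≤ s := by simpa [hv] using hs
    rw [hv, add_zero]
    exact smul_mem_closedFutureCone hs0 ⟨hpp.le, hp.le⟩
  have hn : 0 < ‖v‖ := norm_pos_iff.2 hv
  have hs0 : 0 < s := lt_of_lt_of_le (by positivity) hs
  have hmem : p + s⁻¹ • v ∈ Metric.ball p r := by
    rw [Metric.mem_ball, dist_eq_norm, add_sub_cancel_left, norm_smul, Real.norm_eq_abs,
      abs_of_pos (by positivity), inv_mul_lt_iff₀ hs0]
    rw [div_mul_eq_mul_div, div_le_iff₀ hr] at hs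
    linarith
  have := hball hmem
  have h2 : s • (p + s⁻¹ • v) ∈ closedFutureCone B τ :=
    smul_mem_closedFutureCone hs0.le ⟨this.1.le, this.2.le⟩
  rwa [smul_add, smul_smul, mul_inv_cancel₀ hs0.ne', one_smul] at h2

end NormedCone

/-! ### Causal curves and their lengths -/

section Curves

variable {V : Type*} [NormedAddCommGroup V] [NormedSpace ℝ V]
  {B : LinearMap.BilinForm ℝ V} {τ : V} {f : V → ℝ} {γ γ' : ℝ → V}

/-- A smooth future pointing causal curve on `[p, q]`. -/
def IsCausalPiece (B : LinearMap.BilinForm ℝ V) (τ : V) (γ : ℝ → V) (p q : ℝ) : Prop :=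
  p < q ∧ ContDiffOn ℝ ∞ γ (Icc p q) ∧
    ∀ s ∈ Icc p q, derivWithin γ (Icc p q) s ∈ futureCone B τ

/-- The integrand of `lorentzLength`. -/
noncomputable def lorentzSpeed (B : LinearMap.BilinForm ℝ V) (f : V → ℝ) (γ : ℝ → V) (s : ℝ) : ℝ :=
  Real.sqrt |conformalMetric B f (γ s) (deriv γ s) (deriv γ s)|

theorem lorentzLength_eq (γ : ℝ → V) (a b : ℝ) :
    lorentzLength B f γ a b = ∫ s in a..b, lorentzSpeed B f γ s := rfl

theorem sqrt_abs_conformalMetric (hf : ∀ x, 0 < f x) (x v : V) :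
    Real.sqrt |conformalMetric B f x v v| = f x * formAbs B v := by
  simp only [conformalMetric, formAbs, LinearMap.smul_apply, smul_eq_mul, abs_mul, abs_pow, sq_abs]
  rw [Real.sqrt_mul (by positivity), Real.sqrt_sq (hf x).le]

/-- `deriv` is two-sided and may differ at the end points, hence the open interval. -/
theorem lorentzSpeed_congr {p q : ℝ} (h : EqOn γ γ' (Icc p q)) :
    EqOn (lorentzSpeed B f γ) (lorentzSpeed B f γ') (Ioo p q) := by
  intro s hs
  have : γ =ᶠ[𝓝 s] γ' := by
    filter_upwards [Icc_mem_nhds hs.1 hs.2] with z hz using h hz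
  simp only [lorentzSpeed, this.deriv_eq, this.self_of_nhds]

theorem lorentzLength_congr {p q : ℝ} (hpq : p ≤ q) (h : EqOn γ γ' (Icc p q)) :
    lorentzLength B f γ p q = lorentzLength B f γ' p q :=
  intervalIntegral.integral_congr_Ioo_of_le hpq (lorentzSpeed_congr h)

namespace IsCausalPiece

theorem congr {p q : ℝ} (hγ : IsCausalPiece B τ γ p q) (h : EqOn γ' γ (Icc p q)) :
    IsCausalPiece B τ γ' p q :=
  ⟨hγ.1, hγ.2.1.congr h, fun s hs => by
    rw [derivWithin_congr h (h hs)]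
    exact hγ.2.2 s hs⟩

theorem mono {p q p' q' : ℝ} (hγ : IsCausalPiece B τ γ p q) (hp : p ≤ p') (hpq : p' < q')
    (hq : q' ≤ q) : IsCausalPiece B τ γ p' q' := by
  have hsub : Icc p' q' ⊆ Icc p q := Icc_subset_Icc hp hq
  refine ⟨hpq, hγ.2.1.mono hsub, fun s hs => ?_⟩
  rw [derivWithin_subset hsub (uniqueDiffOn_Icc hpq s hs)
    ((hγ.2.1.differentiableOn (by simp)) s (hsub hs))]
  exact hγ.2.2 s (hsub hs)

theorem continuousOn_derivWithin {p q : ℝ} (hγ : IsCausalPiece B τ γ p q) :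
    ContinuousOn (derivWithin γ (Icc p q)) (Icc p q) :=
  hγ.2.1.continuousOn_derivWithin (uniqueDiffOn_Icc hγ.1) (by exact_mod_cast le_top)

theorem hasDerivAt {p q s : ℝ} (hγ : IsCausalPiece B τ γ p q) (hs : s ∈ Ioo p q) :
    HasDerivAt γ (derivWithin γ (Icc p q) s) s :=
  ((hγ.2.1.differentiableOn (by simp)) s (Ioo_subset_Icc_self hs)).hasDerivWithinAt.hasDerivAt
    (Icc_mem_nhds hs.1 hs.2)

open scoped Pointwise in
theorem comp_add_const {p q : ℝ} (hγ : IsCausalPiece B τ γ p q) (h : ℝ) :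
    IsCausalPiece B τ (fun s => γ (s + h)) (p - h) (q - h) := by
  have himg : h +ᵥ Icc (p - h) (q - h) = Icc p q := by
    ext x
    simp only [mem_vadd_set, vadd_eq_add, mem_Icc]
    constructor
    · rintro ⟨y, hy, rfl⟩
      constructor <;> linarith
    · intro hx
      exact ⟨x - h, by constructor <;> linarith, by ring⟩
  refine ⟨by linarith [hγ.1], ?_, fun s hs => ?_⟩
  · refine hγ.2.1.comp (by fun_prop) fun s hs => ?_
    simp only [mem_Icc] at hs ⊢
    constructor <;> linarith
  · rw [derivWithin_comp_add_const, himg]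
    apply hγ.2.2
    simp only [mem_Icc] at hs ⊢
    constructor <;> linarith

theorem add_const {p q : ℝ} (hγ : IsCausalPiece B τ γ p q) (k : V) :
    IsCausalPiece B τ (fun s => γ s + k) p q :=
  ⟨hγ.1, hγ.2.1.add contDiffOn_const, fun s hs => by
    rw [derivWithin_add_const]
    exact hγ.2.2 s hs⟩

theorem isFutureCausalCurve {p q : ℝ} (hγ : IsCausalPiece B τ γ p q) :
    IsFutureCausalCurve B τ γ p q :=
  ⟨hγ.1, 1, fun i => if i = 0 then p else q, by simp, by simp, by simpa [IsCausalPiece] using hγ⟩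

end IsCausalPiece

theorem lorentzLength_comp_add_const (γ : ℝ → V) (p q h : ℝ) :
    lorentzLength B f (fun s => γ (s + h)) (p - h) (q - h) = lorentzLength B f γ p q := by
  have : ∀ s, lorentzSpeed B f (fun s => γ (s + h)) s = lorentzSpeed B f γ (s + h) := fun s => by
    simp only [lorentzSpeed, deriv_comp_add_const]
  rw [lorentzLength_eq, lorentzLength_eq]
  simp only [this]
  rw [intervalIntegral.integral_comp_add_right (lorentzSpeed B f γ)]
  simp

theorem lorentzLength_add_const {k : V} (hk : ∀ x, f (x + k) = f x) (γ : ℝ → V) (p q : ℝ) :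
    lorentzLength B f (fun s => γ s + k) p q = lorentzLength B f γ p q := by
  simp only [lorentzLength, conformalMetric, deriv_add_const, hk]

theorem lorentzSpeed_eqOn_Ioo (hf : ∀ x, 0 < f x) (γ : ℝ → V) (p q : ℝ) :
    EqOn (fun s => f (γ s) * formAbs B (derivWithin γ (Icc p q) s)) (lorentzSpeed B f γ)
      (Ioo p q) := by
  intro s hs
  simp only [lorentzSpeed, sqrt_abs_conformalMetric hf]
  rw [derivWithin_of_mem_nhds (Icc_mem_nhds hs.1 hs.2)]

namespace IsFutureCausalCurve

theorem comp_add_const {a b : ℝ} (hγ : IsFutureCausalCurve B τ γ a b) (h : ℝ) :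
    IsFutureCausalCurve B τ (fun s => γ (s + h)) (a - h) (b - h) := by
  obtain ⟨hab, n, t, rfl, rfl, ht⟩ := hγ
  exact ⟨by linarith, n, fun i => t i - h, rfl, rfl, fun i hi =>
    IsCausalPiece.comp_add_const (ht i hi) h⟩

theorem add_const {a b : ℝ} (hγ : IsFutureCausalCurve B τ γ a b) (k : V) :
    IsFutureCausalCurve B τ (fun s => γ s + k) a b := by
  obtain ⟨hab, n, t, rfl, rfl, ht⟩ := hγ
  exact ⟨hab, n, t, rfl, rfl, fun i hi => IsCausalPiece.add_const (ht i hi) k⟩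

theorem glue {a b c : ℝ} (hγ : IsFutureCausalCurve B τ γ a b)
    (hγ' : IsFutureCausalCurve B τ γ' b c) (h : γ b = γ' b) :
    IsFutureCausalCurve B τ (fun s => if s ≤ b then γ s else γ' s) a c := by
  obtain ⟨hab, n, t, rfl, rfl, ht⟩ := hγ
  obtain ⟨hbc, m, t', h0, rfl, ht'⟩ := hγ'
  have hmono : ∀ i j, i ≤ j → j ≤ n → t i ≤ t j := by
    intro i j hij
    induction j, hij using Nat.le_induction with
    | base => simp
    | succ j hj ih => intro hjn; exact (ih (by omega)).trans (ht j (by omega)).1.le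
  have hmono' : ∀ j, j ≤ m → t' 0 ≤ t' j := by
    intro j
    induction j with
    | zero => simp
    | succ j ih => intro hjm; exact (ih (by omega)).trans (ht' j (by omega)).1.le
  refine ⟨hab.trans hbc, n + m, fun i => if i ≤ n then t i else t' (i - n), by simp, ?_, ?_⟩
  · rcases Nat.eq_zero_or_pos m with rfl | hm
    · simp [h0]
    · have : ¬ n + m ≤ n := by omega
      simp [this]
  intro i hi
  change IsCausalPiece B τ _ _ _
  beta_reduce
  rcases lt_or_ge i n with hin | hin
  · rw [if_pos hin.le, if_pos (by omega)]
    refine IsCausalPiece.congr (ht i hin) fun s hs => if_pos ?_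
    exact hs.2.trans (hmono _ _ (by omega) le_rfl)
  · obtain ⟨j, rfl⟩ := Nat.exists_eq_add_of_le hin
    have e1 : (if n + j ≤ n then t (n + j) else t' (n + j - n)) = t' j := by
      rcases Nat.eq_zero_or_pos j with rfl | hj
      · simp [h0]
      · rw [if_neg (by omega), Nat.add_sub_cancel_left]
    rw [e1, if_neg (by omega), show n + j + 1 - n = j + 1 by omega]
    refine IsCausalPiece.congr (ht' j (by omega)) fun s hs => ?_
    have hs' : t n ≤ s := by
      rw [← h0]
      exact (hmono' j (by omega)).trans hs.1
    rcases hs'.eq_or_lt with rfl | hs'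
    · simp [h]
    · exact if_neg hs'.not_ge

end IsFutureCausalCurve

variable [FiniteDimensional ℝ V]

namespace IsCausalPiece

theorem intervalIntegrable_aux (hf : Continuous f) {p q : ℝ} (hγ : IsCausalPiece B τ γ p q) :
    IntervalIntegrable (fun s => f (γ s) * formAbs B (derivWithin γ (Icc p q) s))
      MeasureTheory.volume p q := by
  apply ContinuousOn.intervalIntegrable
  rw [uIcc_of_le hγ.1.le]
  exact (hf.comp_continuousOn hγ.2.1.continuousOn).mul
    (continuous_formAbs.comp_continuousOn hγ.continuousOn_derivWithin)

theorem intervalIntegrable (hfc : Continuous f) (hf : ∀ x, 0 < f x) {p q : ℝ}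
    (hγ : IsCausalPiece B τ γ p q) :
    IntervalIntegrable (lorentzSpeed B f γ) MeasureTheory.volume p q :=
  (hγ.intervalIntegrable_aux hfc).congr_uIoo (by
    rw [uIoo_of_le hγ.1.le]
    exact lorentzSpeed_eqOn_Ioo hf γ p q)

/-- The displacement is q - p times the average velocity, and a closed convex cone contains
averages. -/
theorem sub_mem (hB : IsLorentzForm B) (hτ : B τ τ < 0) {p q : ℝ}
    (hγ : IsCausalPiece B τ γ p q) : γ q - γ p ∈ closedFutureCone B τ := by
  have hint : IntervalIntegrable (derivWithin γ (Icc p q)) MeasureTheory.volume p q :=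
    ContinuousOn.intervalIntegrable (by
      rw [uIcc_of_le hγ.1.le]
      exact hγ.continuousOn_derivWithin)
  have h1 := intervalIntegral.integral_eq_sub_of_hasDerivAt_of_le hγ.1.le hγ.2.1.continuousOn
    (fun s hs => hγ.hasDerivAt hs) hint
  have hpq : 0 < q - p := sub_pos.2 hγ.1
  have h2 : (q - p)⁻¹ • (γ q - γ p) ∈ closedFutureCone B τ := by
    rw [← h1, ← interval_average_eq, uIoc_of_le hγ.1.le]
    refine (convex_closedFutureCone hB hτ).set_average_mem isClosed_closedFutureCone ?_ ?_ ?_ ?_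
    · simp [hγ.1]
    · simp
    · refine MeasureTheory.ae_restrict_of_forall_mem measurableSet_Ioc fun s hs => ?_
      exact futureCone_subset (hγ.2.2 s (Ioc_subset_Icc_self hs))
    · exact (intervalIntegrable_iff_integrableOn_Ioc_of_le hγ.1.le).1 hint
  have h3 := smul_mem_closedFutureCone hpq.le h2
  rwa [smul_smul, mul_inv_cancel₀ hpq.ne', one_smul] at h3

/-- Reverse Cauchy–Schwarz bounds the speed by a linear functional of the velocity, which integrates
to its value on the displacement. -/
theorem lorentzLength_mul_le (hB : IsLorentzForm B) (hτ : B τ τ < 0) (hfc : Continuous f)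
    (hf : ∀ x, 0 < f x) {M : ℝ} (hM : ∀ x, f x ≤ M) {p q : ℝ} (hγ : IsCausalPiece B τ γ p q)
    {v : V} (hv : v ∈ closedFutureCone B τ) (hvv : B v v < 0) :
    lorentzLength B f γ p q * formAbs B v ≤ M * -B v (γ q - γ p) := by
  have hlin : Continuous fun w => B v w := continuous_const.form continuous_id
  have hint : IntervalIntegrable (fun s => B v (derivWithin γ (Icc p q) s))
      MeasureTheory.volume p q :=
    ContinuousOn.intervalIntegrable (by
      rw [uIcc_of_le hγ.1.le]
      exact hlin.comp_continuousOn hγ.continuousOn_derivWithin)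
  have h1 := intervalIntegral.integral_eq_sub_of_hasDerivAt_of_le (f := fun s => B v (γ s))
    hγ.1.le (hlin.comp_continuousOn hγ.2.1.continuousOn)
    (fun s hs => (LinearMap.toContinuousLinearMap (B v)).hasFDerivAt.comp_hasDerivAt s
      (hγ.hasDerivAt hs)) hint
  have h2 : B v (γ q - γ p) = ∫ s in p..q, B v (derivWithin γ (Icc p q) s) := by
    rw [map_sub]
    exact h1.symm
  rw [h2, lorentzLength_eq, ← intervalIntegral.integral_congr_Ioo_of_le hγ.1.le
    (lorentzSpeed_eqOn_Ioo hf γ p q), ← intervalIntegral.integral_mul_const,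
    ← intervalIntegral.integral_neg, ← intervalIntegral.integral_const_mul]
  refine intervalIntegral.integral_mono_on hγ.1.le ((hγ.intervalIntegrable_aux hfc).mul_const _)
    (hint.neg.const_mul _) fun s hs => ?_
  have hd := futureCone_subset (hγ.2.2 s hs)
  have hle := formAbs_mul_le hB hτ hv hvv hd
  have h0 : 0 ≤ formAbs B v * formAbs B (derivWithin γ (Icc p q) s) :=
    mul_nonneg (formAbs_nonneg _) (formAbs_nonneg _)
  calc f (γ s) * formAbs B (derivWithin γ (Icc p q) s) * formAbs B v
      = f (γ s) * (formAbs B v * formAbs B (derivWithin γ (Icc p q) s)) := by ring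
    _ ≤ M * (formAbs B v * formAbs B (derivWithin γ (Icc p q) s)) := by
      gcongr
      exact hM _
    _ ≤ _ := by
      have := (hf (γ s)).le.trans (hM _)
      gcongr

end IsCausalPiece

namespace IsFutureCausalCurve

theorem intervalIntegrable (hfc : Continuous f) (hf : ∀ x, 0 < f x) {a b : ℝ}
    (hγ : IsFutureCausalCurve B τ γ a b) :
    IntervalIntegrable (lorentzSpeed B f γ) MeasureTheory.volume a b := by
  obtain ⟨-, n, t, rfl, rfl, ht⟩ := hγ
  exact IntervalIntegrable.trans_iterate fun i hi =>
    IsCausalPiece.intervalIntegrable hfc hf (ht i hi)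

theorem lorentzLength_eq_sum (hfc : Continuous f) (hf : ∀ x, 0 < f x) {n : ℕ} {t : ℕ → ℝ}
    (ht : ∀ i < n, IsCausalPiece B τ γ (t i) (t (i + 1))) :
    lorentzLength B f γ (t 0) (t n) =
      ∑ i ∈ Finset.range n, lorentzLength B f γ (t i) (t (i + 1)) :=
  (intervalIntegral.sum_integral_adjacent_intervals fun i hi =>
    IsCausalPiece.intervalIntegrable hfc hf (ht i hi)).symm

theorem lorentzLength_mul_le (hB : IsLorentzForm B) (hτ : B τ τ < 0) (hfc : Continuous f)
    (hf : ∀ x, 0 < f x) {M : ℝ} (hM : ∀ x, f x ≤ M) {a b : ℝ} (hγ : IsFutureCausalCurve B τ γ a b)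
    {v : V} (hv : v ∈ closedFutureCone B τ) (hvv : B v v < 0) :
    lorentzLength B f γ a b * formAbs B v ≤ M * -B v (γ b - γ a) := by
  obtain ⟨-, n, t, rfl, rfl, ht⟩ := hγ
  rw [lorentzLength_eq_sum hfc hf ht, ← Finset.sum_range_sub (fun i => γ (t i)), map_sum,
    ← Finset.sum_neg_distrib, Finset.sum_mul, Finset.mul_sum]
  exact Finset.sum_le_sum fun i hi =>
    IsCausalPiece.lorentzLength_mul_le hB hτ hfc hf hM (ht i (Finset.mem_range.1 hi)) hv hvv

/-- For timelike displacement w, test the previous bound with v = w. For null w, test with w + δτ: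
the left side has order √δ if w ≠ 0 and the right side order δ, so the length vanishes. For w = 0
the right side is zero. -/
theorem lorentzLength_le (hB : IsLorentzForm B) (hτ : B τ τ < 0) (hfc : Continuous f)
    (hf : ∀ x, 0 < f x) {M : ℝ} (hM : ∀ x, f x ≤ M) {a b : ℝ} (hγ : IsFutureCausalCurve B τ γ a b)
    (hw : γ b - γ a ∈ closedFutureCone B τ) :
    lorentzLength B f γ a b ≤ M * formAbs B (γ b - γ a) := by
  have key := fun v hv hvv => hγ.lorentzLength_mul_le hB hτ hfc hf hM (v := v) hv hvv
  set w := γ b - γ a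
  set L := lorentzLength B f γ a b
  have hMpos : 0 < M := (hf 0).trans_le (hM 0)
  rcases hw.1.lt_or_eq with h | h
  · have h1 := key w hw h
    have hpos : 0 < formAbs B w := by
      rw [formAbs_of_mem hw]
      exact Real.sqrt_pos.2 (by linarith)
    have h2 : -B w w = formAbs B w * formAbs B w := by
      rw [formAbs_of_mem hw, Real.mul_self_sqrt (by linarith)]
    rw [h2, ← mul_assoc] at h1
    exact le_of_mul_le_mul_right h1 hpos
  · have h0 : formAbs B w = 0 := by simp [formAbs, h]
    rw [h0, mul_zero]
    by_contra hL
    push Not at hL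
    have hwτ : B w τ = B τ w := hB.symm w τ
    have hτm := futureCone_subset (mem_futureCone_self hτ)
    have hδ : ∀ δ : ℝ, 0 < δ → L ^ 2 * (2 * (-B τ w) + δ * (-B τ τ)) ≤
        M ^ 2 * (-B τ w) ^ 2 * δ := by
      intro δ hδ
      have hm : w + δ • τ ∈ closedFutureCone B τ :=
        add_mem_closedFutureCone hB hτ hw (smul_mem_closedFutureCone hδ.le hτm)
      have hsq : -B (w + δ • τ) (w + δ • τ) = δ * (2 * (-B τ w) + δ * (-B τ τ)) := by
        simp only [map_add, map_smul, LinearMap.add_apply, LinearMap.smul_apply, smul_eq_mul, hwτ,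
          h]
        ring
      have hpos : 0 < δ * (2 * (-B τ w) + δ * (-B τ τ)) := by
        have h1 := hw.2
        have : 0 < 2 * (-B τ w) + δ * (-B τ τ) := by nlinarith
        positivity
      have h1 := key _ hm (by linarith)
      rw [formAbs_of_mem hm, hsq] at h1
      have h2 : -B (w + δ • τ) w = δ * (-B τ w) := by
        simp only [map_add, map_smul, LinearMap.add_apply, LinearMap.smul_apply, smul_eq_mul, h]
        ring
      rw [h2] at h1
      have h3 := mul_self_le_mul_self (by positivity) h1
      rw [mul_mul_mul_comm, Real.mul_self_sqrt hpos.le] at h3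
      refine le_of_mul_le_mul_left ?_ hδ
      linarith
    have hc : 0 ≤ -B τ w := by linarith [hw.2]
    rcases hc.eq_or_lt with hc | hc
    · have := hδ 1 one_pos
      rw [← hc] at this
      have : L ^ 2 * (-B τ τ) ≤ 0 := by linarith
      have : 0 < L ^ 2 * (-B τ τ) := mul_pos (by positivity) (by linarith)
      linarith
    · have h1 := hδ (L ^ 2 / (M ^ 2 * (-B τ w))) (by positivity)
      have h2 : M ^ 2 * (-B τ w) ^ 2 * (L ^ 2 / (M ^ 2 * (-B τ w))) = L ^ 2 * (-B τ w) := by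
        field_simp
      have h3 : 0 < L ^ 2 / (M ^ 2 * (-B τ w)) * (-B τ τ) := mul_pos (by positivity) (by linarith)
      rw [h2] at h1
      have h4 : 0 < L ^ 2 := by positivity
      nlinarith [mul_pos h4 h3, mul_pos h4 hc]

theorem lorentzLength_glue (hfc : Continuous f) (hf : ∀ x, 0 < f x) {a b c : ℝ}
    (hγ : IsFutureCausalCurve B τ γ a b) (hγ' : IsFutureCausalCurve B τ γ' b c) (h : γ b = γ' b) :
    lorentzLength B f (fun s => if s ≤ b then γ s else γ' s) a c =
      lorentzLength B f γ a b + lorentzLength B f γ' b c := by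
  have h1 : EqOn γ (fun s => if s ≤ b then γ s else γ' s) (Icc a b) := fun s hs =>
    (if_pos hs.2).symm
  have h2 : EqOn γ' (fun s => if s ≤ b then γ s else γ' s) (Icc b c) := fun s hs => by
    rcases hs.1.eq_or_lt with rfl | hs'
    · simp [h]
    · exact (if_neg hs'.not_ge).symm
  rw [lorentzLength_congr hγ.1.le h1, lorentzLength_congr hγ'.1.le h2]
  refine (intervalIntegral.integral_add_adjacent_intervals ?_ ?_).symm
  · refine (hγ.intervalIntegrable hfc hf).congr_uIoo ?_
    rw [uIoo_of_le hγ.1.le]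
    exact lorentzSpeed_congr h1
  · refine (hγ'.intervalIntegrable hfc hf).congr_uIoo ?_
    rw [uIoo_of_le hγ'.1.le]
    exact lorentzSpeed_congr h2

end IsFutureCausalCurve

end Curves

/-! ### The time separation as a periodic superadditive function -/

/-- The properties of the time separation of a periodic conformally flat Lorentzian metric used in
the study of its asymptotic behaviour. -/
structure IsPeriodicSeparation {V : Type*} [NormedAddCommGroup V] [NormedSpace ℝ V]
    (B : LinearMap.BilinForm ℝ V) (τ : V) (Γ : Submodule ℤ V) (m M : ℝ) (D : V → V → ℝ) :
    Prop where
  nonneg : ∀ x y, 0 ≤ D x y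
  periodic : ∀ k ∈ Γ, ∀ x y, D (x + k) (y + k) = D x y
  add_le : ∀ x y z, y - x ∈ closedFutureCone B τ → z - y ∈ closedFutureCone B τ →
    D x y + D y z ≤ D x z
  le_formAbs : ∀ x y, y - x ∈ closedFutureCone B τ → D x y ≤ M * formAbs B (y - x)
  formAbs_le : ∀ x y, y - x ∈ closedFutureCone B τ → m * formAbs B (y - x) ≤ D x y
  exists_chain : ∀ x y, y - x ∈ closedFutureCone B τ → ∃ (N : ℕ) (c : ℕ → V), c 0 = x ∧ c N = y ∧
    (∀ i < N, c (i + 1) - c i ∈ closedFutureCone B τ ∧ ‖c (i + 1) - c i‖ ≤ 1) ∧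
    D x y ≤ 1 + ∑ i ∈ Finset.range N, D (c i) (c (i + 1))

section TimeSeparation

variable {V : Type*} [NormedAddCommGroup V] [NormedSpace ℝ V]
  {B : LinearMap.BilinForm ℝ V} {τ : V} {f : V → ℝ} {γ : ℝ → V}

/-- There is a causal chain from `x` to `y` with short steps whose total `D`-length is at least
`L`. -/
def HasFineChain (B : LinearMap.BilinForm ℝ V) (τ : V) (D : V → V → ℝ) (x y : V) (L : ℝ) : Prop :=
  ∃ (N : ℕ) (c : ℕ → V), c 0 = x ∧ c N = y ∧
    (∀ i < N, c (i + 1) - c i ∈ closedFutureCone B τ ∧ ‖c (i + 1) - c i‖ ≤ 1) ∧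
    L ≤ ∑ i ∈ Finset.range N, D (c i) (c (i + 1))

theorem HasFineChain.refl (D : V → V → ℝ) (x : V) : HasFineChain B τ D x x 0 :=
  ⟨0, fun _ => x, rfl, rfl, fun i hi => absurd hi (by omega), by simp⟩

theorem HasFineChain.trans {D : V → V → ℝ} {x y z : V} {L L' : ℝ} (h : HasFineChain B τ D x y L)
    (h' : HasFineChain B τ D y z L') : HasFineChain B τ D x z (L + L') := by
  obtain ⟨n, c, rfl, rfl, hc, hL⟩ := h
  obtain ⟨m, c', h0, rfl, hc', hL'⟩ := h'
  have e1 : ∀ i ≤ n, (if i ≤ n then c i else c' (i - n)) = c i := fun i hi => if_pos hi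
  have e2 : ∀ j, (if n + j ≤ n then c (n + j) else c' (n + j - n)) = c' j := by
    intro j
    rcases Nat.eq_zero_or_pos j with rfl | hj
    · simp [h0]
    · rw [if_neg (by omega), Nat.add_sub_cancel_left]
  refine ⟨n + m, fun i => if i ≤ n then c i else c' (i - n), e1 0 (by omega), e2 m, ?_, ?_⟩
  · intro i hi
    beta_reduce
    rcases lt_or_ge i n with hin | hin
    · rw [e1 i hin.le, e1 (i + 1) hin]
      exact hc i hin
    · obtain ⟨j, rfl⟩ := Nat.exists_eq_add_of_le hin
      rw [e2 j, add_assoc, e2 (j + 1)]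
      exact hc' j (by omega)
  · rw [Finset.sum_range_add]
    refine add_le_add (hL.trans_eq (Finset.sum_congr rfl fun i hi => ?_))
      (hL'.trans_eq (Finset.sum_congr rfl fun j _ => ?_))
    · rw [Finset.mem_range] at hi
      beta_reduce
      rw [e1 i hi.le, e1 (i + 1) hi]
    · beta_reduce
      rw [e2 j, add_assoc, e2 (j + 1)]

theorem le_timeSeparation {a b : ℝ} (hγ : IsFutureCausalCurve B τ γ a b) :
    ENNReal.ofReal (lorentzLength B f γ a b) ≤ timeSeparation B τ f (γ a) (γ b) :=
  le_sSup ⟨γ, a, b, hγ, rfl, rfl, rfl⟩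

theorem timeSeparation_add_le {k : V} (hk : ∀ x, f (x + k) = f x) (x y : V) :
    timeSeparation B τ f x y ≤ timeSeparation B τ f (x + k) (y + k) := by
  refine sSup_le ?_
  rintro _ ⟨γ, a, b, hγ, rfl, rfl, rfl⟩
  rw [← lorentzLength_add_const hk]
  exact le_timeSeparation (hγ.add_const k)

theorem timeSeparation_add {Γ : Submodule ℤ V} (hΓ : ∀ k ∈ Γ, ∀ x, f (x + k) = f x) {k : V}
    (hk : k ∈ Γ) (x y : V) :
    timeSeparation B τ f (x + k) (y + k) = timeSeparation B τ f x y := by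
  refine le_antisymm ?_ (timeSeparation_add_le (hΓ k hk) x y)
  simpa using timeSeparation_add_le (B := B) (τ := τ) (hΓ (-k) (neg_mem hk)) (x + k) (y + k)

theorem isCausalPiece_line (x : V) {v : V} (hv : v ∈ futureCone B τ) :
    IsCausalPiece B τ (fun s : ℝ => x + s • v) 0 1 := by
  have hd : ∀ s : ℝ, HasDerivAt (fun s : ℝ => x + s • v) v s := fun s => by
    simpa using ((hasDerivAt_id s).smul_const v).const_add x
  refine ⟨one_pos, ContDiff.contDiffOn (by fun_prop), fun s hs => ?_⟩
  rw [(hd s).hasDerivWithinAt.derivWithin (uniqueDiffOn_Icc one_pos s hs)]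
  exact hv

theorem IsFutureCausalCurve.lorentzLength_le_toReal {a b : ℝ}
    (hγ : IsFutureCausalCurve B τ γ a b) (h : timeSeparation B τ f (γ a) (γ b) ≠ ⊤) :
    lorentzLength B f γ a b ≤ (timeSeparation B τ f (γ a) (γ b)).toReal :=
  (ENNReal.ofReal_le_iff_le_toReal h).1 (le_timeSeparation hγ)

theorem lorentzLength_nonneg {a b : ℝ} (hab : a ≤ b) : 0 ≤ lorentzLength B f γ a b :=
  intervalIntegral.integral_nonneg hab fun _ _ => Real.sqrt_nonneg _

variable [FiniteDimensional ℝ V]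

theorem timeSeparation_le (hB : IsLorentzForm B) (hτ : B τ τ < 0) (hfc : Continuous f)
    (hf : ∀ x, 0 < f x) {M : ℝ} (hM : ∀ x, f x ≤ M) {x y : V}
    (h : y - x ∈ closedFutureCone B τ) :
    timeSeparation B τ f x y ≤ ENNReal.ofReal (M * formAbs B (y - x)) := by
  refine sSup_le ?_
  rintro _ ⟨γ, a, b, hγ, rfl, rfl, rfl⟩
  exact ENNReal.ofReal_le_ofReal (hγ.lorentzLength_le hB hτ hfc hf hM h)

theorem le_toReal_timeSeparation (hf : ∀ x, 0 < f x) (hfc : Continuous f) {m : ℝ}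
    (hm : ∀ x, m ≤ f x) (x : V) {v : V} (hv : v ∈ futureCone B τ)
    (h : timeSeparation B τ f x (x + v) ≠ ⊤) :
    m * formAbs B v ≤ (timeSeparation B τ f x (x + v)).toReal := by
  have hγ := isCausalPiece_line x hv
  have hγ' := hγ.isFutureCausalCurve.lorentzLength_le_toReal (f := f) (by simpa using h)
  simp only [zero_smul, add_zero, one_smul] at hγ'
  refine le_trans ?_ hγ'
  have hd : ∀ s : ℝ, deriv (fun s : ℝ => x + s • v) s = v := fun s => by
    simpa using (((hasDerivAt_id s).smul_const v).const_add x).deriv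
  calc m * formAbs B v = ∫ s in (0 : ℝ)..1, m * formAbs B v := by simp
    _ ≤ _ := by
      refine intervalIntegral.integral_mono_on zero_le_one (by simp)
        (hγ.intervalIntegrable hfc hf) fun s _ => ?_
      rw [sqrt_abs_conformalMetric hf, hd]
      exact mul_le_mul_of_nonneg_right (hm _) (formAbs_nonneg _)

theorem timeSeparation_add_timeSeparation_le (hfc : Continuous f)
    (hf : ∀ x, 0 < f x) {x y z : V} (hxy : y - x ∈ futureCone B τ) (hyz : z - y ∈ futureCone B τ) :
    timeSeparation B τ f x y + timeSeparation B τ f y z ≤ timeSeparation B τ f x z := by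
  -- Adding suprema in `ENNReal` needs both families of curves to be nonempty; straight segments
  -- provide members.
  have hne : ∀ x y : V, y - x ∈ futureCone B τ → ∃ L, ∃ (γ : ℝ → V) (a b : ℝ),
      IsFutureCausalCurve B τ γ a b ∧ γ a = x ∧ γ b = y ∧
        L = ENNReal.ofReal (lorentzLength B f γ a b) := fun x y h =>
    ⟨_, _, 0, 1, (isCausalPiece_line x h).isFutureCausalCurve, by simp, by simp, rfl⟩
  unfold timeSeparation
  rw [sSup_eq_iSup, sSup_eq_iSup]
  refine ENNReal.biSup_add_biSup_le' (hne _ _ hxy) (hne _ _ hyz) ?_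
  rintro _ ⟨γ, a, b, hγ, rfl, hb, rfl⟩ _ ⟨γ', a', b', hγ', ha', rfl, rfl⟩
  have h1 := hγ'.comp_add_const (a' - b)
  have hL := lorentzLength_comp_add_const (B := B) (f := f) γ' a' b' (a' - b)
  rw [sub_sub_cancel] at h1 hL
  have hglue : γ b = (fun s => γ' (s + (a' - b))) b := by simp [hb, ha']
  rw [← ENNReal.ofReal_add (lorentzLength_nonneg hγ.1.le) (lorentzLength_nonneg hγ'.1.le), ← hL,
    ← hγ.lorentzLength_glue hfc hf h1 hglue]
  refine le_sSup ⟨_, _, _, hγ.glue h1 hglue, by simp [hγ.1.le], ?_, rfl⟩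
  have hlt := h1.1
  rw [if_neg hlt.not_ge]
  simp

/-- Uniform continuity gives a subdivision with steps of norm at most 1, and the length of each arc
is at most the separation of its ends. -/
theorem IsCausalPiece.hasFineChain (hB : IsLorentzForm B) (hτ : B τ τ < 0) (hfc : Continuous f)
    (hf : ∀ x, 0 < f x)
    (hfin : ∀ x y, y - x ∈ closedFutureCone B τ → timeSeparation B τ f x y ≠ ⊤) {p q : ℝ}
    (hγ : IsCausalPiece B τ γ p q) :
    HasFineChain B τ (fun x y => (timeSeparation B τ f x y).toReal) (γ p) (γ q)
      (lorentzLength B f γ p q) := by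
  obtain ⟨δ, hδ, hu⟩ := Metric.uniformContinuousOn_iff.1
    (isCompact_Icc.uniformContinuousOn_of_continuous hγ.2.1.continuousOn) 1 one_pos
  obtain ⟨n, hn⟩ := exists_nat_gt ((q - p) / δ)
  have hpq : 0 < q - p := sub_pos.2 hγ.1
  have hn0 : (0 : ℝ) < n := lt_of_le_of_lt (by positivity) hn
  set t : ℕ → ℝ := fun i => p + i * ((q - p) / n) with ht
  have hstep : 0 < (q - p) / n := by positivity
  have hsucc : ∀ i, t (i + 1) = t i + (q - p) / n := fun i => by
    simp only [ht]; push_cast; ring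
  have ht0 : t 0 = p := by simp [ht]
  have htn : t n = q := by simp only [ht]; field_simp; ring
  have hlow : ∀ i, p ≤ t i := fun i => by
    have : 0 ≤ i * ((q - p) / n) := by positivity
    simp only [ht]; linarith
  have hhigh : ∀ i ≤ n, t i ≤ q := fun i hi => by
    have hi' : (i : ℝ) ≤ n := by exact_mod_cast hi
    rw [← htn]
    simp only [ht]
    gcongr
  have hpiece : ∀ i < n, IsCausalPiece B τ γ (t i) (t (i + 1)) := fun i hi =>
    hγ.mono (hlow i) (by rw [hsucc]; linarith) (hhigh (i + 1) hi)
  refine ⟨n, fun i => γ (t i), by simp only [ht0], by simp only [htn], fun i hi => ⟨?_, ?_⟩, ?_⟩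
  · exact (hpiece i hi).sub_mem hB hτ
  · rw [← dist_eq_norm]
    refine (hu _ ⟨hlow _, hhigh _ hi⟩ _ ⟨hlow _, hhigh _ hi.le⟩ ?_).le
    rw [hsucc, Real.dist_eq, add_sub_cancel_left, abs_of_pos hstep, div_lt_iff₀ hn0]
    rw [div_lt_iff₀ hδ] at hn
    linarith
  · have hsum := IsFutureCausalCurve.lorentzLength_eq_sum hfc hf hpiece
    rw [ht0, htn] at hsum
    rw [hsum]
    exact Finset.sum_le_sum fun i hi =>
      (hpiece i (Finset.mem_range.1 hi)).isFutureCausalCurve.lorentzLength_le_toReal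
        (hfin _ _ ((hpiece i (Finset.mem_range.1 hi)).sub_mem hB hτ))

theorem IsFutureCausalCurve.hasFineChain (hB : IsLorentzForm B) (hτ : B τ τ < 0)
    (hfc : Continuous f) (hf : ∀ x, 0 < f x)
    (hfin : ∀ x y, y - x ∈ closedFutureCone B τ → timeSeparation B τ f x y ≠ ⊤) {a b : ℝ}
    (hγ : IsFutureCausalCurve B τ γ a b) :
    HasFineChain B τ (fun x y => (timeSeparation B τ f x y).toReal) (γ a) (γ b)
      (lorentzLength B f γ a b) := by
  obtain ⟨-, n, t, rfl, rfl, ht⟩ := hγ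
  have : ∀ i ≤ n, HasFineChain B τ (fun x y => (timeSeparation B τ f x y).toReal) (γ (t 0))
      (γ (t i)) (∑ j ∈ Finset.range i, lorentzLength B f γ (t j) (t (j + 1))) := by
    intro i
    induction i with
    | zero => exact fun _ => by simpa using HasFineChain.refl _ _
    | succ i ih =>
      intro hi
      rw [Finset.sum_range_succ]
      exact (ih (by omega)).trans (IsCausalPiece.hasFineChain hB hτ hfc hf hfin (ht i hi))
  rw [lorentzLength_eq_sum hfc hf ht]
  exact this n le_rfl

theorem isPeriodicSeparation_timeSeparation (hB : IsLorentzForm B) (hτ : B τ τ < 0)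
    (hfc : Continuous f) (hf : ∀ x, 0 < f x) {m M : ℝ} (hm : ∀ x, m ≤ f x) (hM : ∀ x, f x ≤ M)
    {Γ : Submodule ℤ V} (hΓ : ∀ k ∈ Γ, ∀ x, f (x + k) = f x) :
    IsPeriodicSeparation B τ Γ m M fun x y => (timeSeparation B τ f x y).toReal := by
  have hfin : ∀ x y, y - x ∈ closedFutureCone B τ → timeSeparation B τ f x y ≠ ⊤ :=
    fun x y h => ((timeSeparation_le hB hτ hfc hf hM h).trans_lt ENNReal.ofReal_lt_top).ne
  have hM0 : 0 ≤ M := (hf 0).le.trans (hM 0)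
  have hle : ∀ x y, y - x ∈ closedFutureCone B τ →
      (timeSeparation B τ f x y).toReal ≤ M * formAbs B (y - x) := fun x y h =>
    ENNReal.toReal_le_of_le_ofReal (mul_nonneg hM0 (formAbs_nonneg _))
      (timeSeparation_le hB hτ hfc hf hM h)
  have hself : ∀ x, (timeSeparation B τ f x x).toReal = 0 := fun x => by
    have := hle x x (by simpa using zero_mem_closedFutureCone)
    rw [sub_self, show formAbs B (0 : V) = 0 by simp [formAbs], mul_zero] at this
    exact le_antisymm this ENNReal.toReal_nonneg
  refine ⟨fun x y => ENNReal.toReal_nonneg, fun k hk x y => ?_, fun x y z hxy hyz => ?_, hle,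
    fun x y h => ?_, fun x y h => ?_⟩
  · rw [timeSeparation_add hΓ hk]
  · have hxz : z - x ∈ closedFutureCone B τ := by
      simpa using add_mem_closedFutureCone hB hτ hxy hyz
    by_cases h1 : y = x
    · rw [h1, hself, zero_add]
    by_cases h2 : z = y
    · rw [h2, hself, add_zero]
    rw [← ENNReal.toReal_add (hfin _ _ hxy) (hfin _ _ hyz)]
    exact ENNReal.toReal_mono (hfin _ _ hxz) (timeSeparation_add_timeSeparation_le hfc hf
      ((mem_futureCone_iff hB hτ).2 ⟨hxy, sub_ne_zero.2 h1⟩)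
      ((mem_futureCone_iff hB hτ).2 ⟨hyz, sub_ne_zero.2 h2⟩))
  · by_cases h1 : y = x
    · simp [h1, formAbs]
    have := le_toReal_timeSeparation hf hfc hm x
      ((mem_futureCone_iff hB hτ).2 ⟨h, sub_ne_zero.2 h1⟩) (by simpa using hfin x y h)
    simpa using this
  · by_cases h1 : y = x
    · exact ⟨0, fun _ => x, rfl, h1.symm, fun i hi => absurd hi (by omega), by simp [h1, hself]⟩
    have hv := (mem_futureCone_iff hB hτ).2 ⟨h, sub_ne_zero.2 h1⟩
    obtain ⟨γ, a, b, hγ, rfl, rfl, hL⟩ : ∃ (γ : ℝ → V) (a b : ℝ), IsFutureCausalCurve B τ γ a b ∧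
        γ a = x ∧ γ b = y ∧
        (timeSeparation B τ f x y).toReal ≤ 1 + lorentzLength B f γ a b := by
      -- When D ≤ 1 any causal curve is long enough. The case is split off because `ENNReal.ofReal`
      -- truncates D - 1 at zero.
      by_cases hD : (timeSeparation B τ f x y).toReal ≤ 1
      · refine ⟨_, 0, 1, (isCausalPiece_line x hv).isFutureCausalCurve, by simp, by simp, ?_⟩
        have : 0 ≤ lorentzLength B f (fun s : ℝ => x + s • (y - x)) 0 1 :=
          lorentzLength_nonneg zero_le_one
        linarith
      · push Not at hD
        have hlt : ENNReal.ofReal ((timeSeparation B τ f x y).toReal - 1) <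
            timeSeparation B τ f x y := by
          rw [ENNReal.ofReal_lt_iff_lt_toReal (by linarith) (hfin x y h)]
          linarith
        obtain ⟨_, ⟨γ, a, b, hγ, ha, hb, rfl⟩, hlt⟩ := lt_sSup_iff.1 hlt
        refine ⟨γ, a, b, hγ, ha, hb, ?_⟩
        have := (ENNReal.ofReal_lt_ofReal_iff_of_nonneg (by linarith)).1 hlt
        linarith
    obtain ⟨N, c, h0, hN, hc, hsum⟩ := hγ.hasFineChain hB hτ hfc hf hfin
    exact ⟨N, c, h0, hN, hc, by linarith⟩

end TimeSeparation

/-! ### Lattice approximation, balls in the cone, Fekete's lemma -/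

theorem exists_norm_sub_mem_le {V : Type*} [NormedAddCommGroup V] [NormedSpace ℝ V]
    [FiniteDimensional ℝ V] (Γ : Submodule ℤ V) [DiscreteTopology Γ] [IsZLattice ℝ Γ] :
    ∃ r : ℝ, 0 ≤ r ∧ ∀ z : V, ∃ k ∈ Γ, ‖k - z‖ ≤ r := by
  have := ZLattice.module_free ℝ Γ
  have := ZLattice.module_finite ℝ Γ
  let b := (Module.Free.chooseBasis ℤ Γ).ofZLatticeBasis ℝ Γ
  refine ⟨∑ i, ‖b i‖, by positivity, fun z => ⟨(ZSpan.floor b z : V), ?_, ?_⟩⟩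
  · have h := (ZSpan.floor b z).2
    exact (Module.Basis.ofZLatticeBasis_span ℝ Γ _).le h
  · rw [← norm_neg, neg_sub, ← ZSpan.fract_apply]
    exact ZSpan.norm_fract_le b z

/-- The open ball misses the frontier and is connected, so it cannot meet both the interior and the
exterior. -/
theorem ball_subset_of_le_infDist_frontier {V : Type*} [NormedAddCommGroup V] [NormedSpace ℝ V]
    {s : Set V} {v : V} {r : ℝ} (hv : v ∈ s) (hr : r ≤ Metric.infDist v (frontier s)) :
    Metric.ball v r ⊆ s := by
  intro w hw
  have hf : ∀ y ∈ Metric.ball v r, y ∈ interior s ∪ interior sᶜ := fun y hy => by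
    rw [← compl_frontier_eq_union_interior]
    intro hyf
    have := Metric.infDist_le_dist_of_mem (x := v) hyf
    rw [Metric.mem_ball, dist_comm] at hy
    linarith
  by_contra hws
  have hv' := Metric.mem_ball_self (x := v) (dist_nonneg.trans_lt hw)
  obtain ⟨y, -, hy, hy'⟩ := (convex_ball v r).isPreconnected _ _ isOpen_interior isOpen_interior hf
    ⟨v, hv', (hf v hv').resolve_right fun h => interior_subset h hv⟩
    ⟨w, hw, (hf w hw).resolve_left fun h => hws (interior_subset h)⟩
  exact interior_subset hy' (interior_subset hy)

/-- Fekete's lemma for nonnegative superadditive functions of a real variable. -/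
theorem exists_tendsto_div_of_superadditive {h : ℝ → ℝ} {K : ℝ} (h0 : ∀ s, 0 ≤ h s)
    (hadd : ∀ s t, 0 ≤ s → 0 ≤ t → h s + h t ≤ h (s + t)) (hK : ∀ s, 0 ≤ s → h s ≤ K * s) :
    ∃ L, Tendsto (fun s => h s / s) atTop (𝓝 L) ∧ ∀ s, 0 < s → h s / s ≤ L := by
  have hbdd : BddAbove ((fun s => h s / s) '' Ioi 0) := by
    refine ⟨K, ?_⟩
    rintro _ ⟨s, hs, rfl⟩
    exact (div_le_iff₀ hs).2 (hK s (le_of_lt hs))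
  have hne : ((fun s => h s / s) '' Ioi (0 : ℝ)).Nonempty := ⟨_, 1, mem_Ioi.2 one_pos, rfl⟩
  set L := sSup ((fun s => h s / s) '' Ioi (0 : ℝ)) with hL
  have hle : ∀ s, 0 < s → h s / s ≤ L := fun s hs => le_csSup hbdd ⟨s, hs, rfl⟩
  have hmul : ∀ (n : ℕ) (s : ℝ), 0 ≤ s → n * h s ≤ h (n * s) := by
    intro n s hs
    induction n with
    | zero => simpa using h0 0
    | succ n ih =>
      have := hadd (n * s) s (by positivity) hs
      push_cast
      rw [add_mul, add_mul, one_mul, one_mul]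
      linarith
  refine ⟨L, ?_, hle⟩
  rw [tendsto_order]
  constructor
  · intro a ha
    obtain ⟨_, ⟨s, hs, rfl⟩, has⟩ := exists_lt_of_lt_csSup hne ha
    have hs : 0 < s := hs
    have hlim : Tendsto (fun S : ℝ => h s / s - h s / S) atTop (𝓝 (h s / s - 0)) :=
      tendsto_const_nhds.sub (tendsto_const_nhds.div_atTop tendsto_id)
    rw [sub_zero] at hlim
    filter_upwards [hlim.eventually (lt_mem_nhds has), eventually_gt_atTop 0] with S hS hS0
    refine hS.trans_le ?_
    -- Split S into n steps of length s and a remainder, on which only h ≥ 0 is used; at most one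
    -- step is lost.
    have hfl := Nat.floor_le (show 0 ≤ S / s by positivity)
    have hfl' := Nat.lt_floor_add_one (S / s)
    set n := ⌊S / s⌋₊
    rw [le_div_iff₀ hs] at hfl
    have h1 := hadd (n * s) (S - n * s) (by positivity) (by linarith)
    have h2 := hmul n s hs.le
    have h3 := h0 (S - n * s)
    rw [add_sub_cancel] at h1
    rw [le_div_iff₀ hS0, sub_mul, div_mul_cancel₀ _ hS0.ne']
    have h4 : h s / s * S = S / s * h s := by ring
    rw [h4]
    nlinarith [h0 s, mul_nonneg (h0 s) (by linarith : 0 ≤ (n : ℝ) + 1 - S / s)]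
  · intro a ha
    filter_upwards [eventually_gt_atTop 0] with S hS
    exact (hle S hS).trans_lt ha

/-! ### Shift profiles and approximate halving -/

section Asymptotics

variable {V : Type*} [NormedAddCommGroup V] [NormedSpace ℝ V]
  {B : LinearMap.BilinForm ℝ V} {τ : V} {D : V → V → ℝ} {g : V → ℝ}

/-- `g` is a superadditive function on the cone which controls `D` up to a shift by `s • τ`. -/
structure IsShiftProfile (B : LinearMap.BilinForm ℝ V) (τ : V) (D : V → V → ℝ) (s : ℝ)
    (g : V → ℝ) : Prop where
  shift_nonneg : 0 ≤ s
  nonneg : ∀ u, 0 ≤ g u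
  add_le : ∀ u ∈ closedFutureCone B τ, ∀ w ∈ closedFutureCone B τ, g u + g w ≤ g (u + w)
  le_sep : ∀ u ∈ closedFutureCone B τ, ∀ p, g u ≤ D p (p + u)
  sep_le : ∀ u ∈ closedFutureCone B τ, ∀ p, D p (p + u) ≤ g (u + s • τ)

namespace IsShiftProfile

theorem mono {s : ℝ} (hg : IsShiftProfile B τ D s g) {u w : V}
    (hu : u ∈ closedFutureCone B τ) (hw : w - u ∈ closedFutureCone B τ) : g u ≤ g w := by
  have := hg.add_le u hu _ hw
  rw [add_sub_cancel] at this
  linarith [hg.nonneg (w - u)]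

/-- Along a chain with alternating signs, the pieces of either sign can be rearranged. -/
theorem sum_chain_le (hB : IsLorentzForm B) (hτ : B τ τ < 0) {Γ : Submodule ℤ V} {m M s : ℝ}
    (hD : IsPeriodicSeparation B τ Γ m M D) (hg : IsShiftProfile B τ D s g) {N : ℕ} {c : ℕ → V}
    (hc : ∀ i < N, c (i + 1) - c i ∈ closedFutureCone B τ) (n : ℕ → ℕ)
    (hn : ∀ i, n (i + 1) = n i ∨ n (i + 1) = n i + 1) (hn0 : n 0 = 0) :
    ∀ i ≤ N, ∃ (j : ℕ) (A A' : V) (a a' : ℕ),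
      A ∈ closedFutureCone B τ ∧ A' ∈ closedFutureCone B τ ∧ c i - c j ∈ closedFutureCone B τ ∧
      a ≤ n i ∧ a' ≤ n i ∧
      A + (c i - c j) = (1 / 2 : ℝ) • (c i - c 0 +
        (-1 : ℝ) ^ n i • ∑ k ∈ Finset.range i, (-1 : ℝ) ^ n k • (c (k + 1) - c k)) +
          ((a : ℝ) * s) • τ ∧
      A' = (1 / 2 : ℝ) • (c i - c 0 -
        (-1 : ℝ) ^ n i • ∑ k ∈ Finset.range i, (-1 : ℝ) ^ n k • (c (k + 1) - c k)) +
          ((a' : ℝ) * s) • τ ∧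
      ∑ k ∈ Finset.range i, D (c k) (c (k + 1)) ≤ g A + g A' + D (c j) (c i) := by
  -- Invariant of the induction: the current piece starts at j, A collects the finished pieces of
  -- its sign and A' those of the opposite sign, and a, a' count the shifts s • τ spent on them.
  -- Half of the total displacement plus or minus the signed sum isolates the steps of one sign.
  intro i
  induction i with
  | zero =>
    intro _
    refine ⟨0, 0, 0, 0, 0, zero_mem_closedFutureCone, zero_mem_closedFutureCone,
      by simpa using zero_mem_closedFutureCone, by omega, by omega, by simp, by simp, ?_⟩
    have h1 := hg.nonneg 0
    have h2 := hD.nonneg (c 0) (c 0)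
    simp only [Finset.range_zero, Finset.sum_empty]
    linarith
  | succ i ih =>
    intro hi
    obtain ⟨j, A, A', a, a', hA, hA', hj, ha, ha', h1, h2, h3⟩ := ih (by omega)
    have hstep := hc i hi
    have hj' : c (i + 1) - c j ∈ closedFutureCone B τ := by
      simpa using add_mem_closedFutureCone hB hτ hstep hj
    have hsq : ((-1 : ℝ) ^ n i) * (-1) ^ n i = 1 := by rw [← mul_pow]; norm_num
    set W := ∑ k ∈ Finset.range i, (-1 : ℝ) ^ n k • (c (k + 1) - c k)
    have hW : (-1 : ℝ) ^ n i • (W + (-1 : ℝ) ^ n i • (c (i + 1) - c i)) =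
        (-1 : ℝ) ^ n i • W + (c (i + 1) - c i) := by
      rw [smul_add, smul_smul, hsq, one_smul]
    have hadd := hD.add_le (c j) (c i) (c (i + 1)) hj hstep
    have h1' : A + (c (i + 1) - c j) = (1 / 2 : ℝ) • (c (i + 1) - c 0 +
        ((-1 : ℝ) ^ n i • W + (c (i + 1) - c i))) + ((a : ℝ) * s) • τ := by
      have : A + (c (i + 1) - c j) = A + (c i - c j) + (c (i + 1) - c i) := by abel
      rw [this, h1]
      module
    have h2' : A' = (1 / 2 : ℝ) • (c (i + 1) - c 0 -
        ((-1 : ℝ) ^ n i • W + (c (i + 1) - c i))) + ((a' : ℝ) * s) • τ := by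
      rw [h2]
      module
    rw [Finset.sum_range_succ, Finset.sum_range_succ]
    rcases hn i with h | h
    · refine ⟨j, A, A', a, a', hA, hA', hj', by omega, by omega, ?_, ?_, by linarith⟩
      · rw [h, hW]; exact h1'
      · rw [h, hW]; exact h2'
    -- At a cut the current piece is shifted and joins the pieces of its sign. The sign then flips,
    -- so A and A' exchange roles.
    · have hs : s • τ ∈ closedFutureCone B τ :=
        smul_mem_closedFutureCone hg.shift_nonneg (futureCone_subset (mem_futureCone_self hτ))
      have hsum := add_mem_closedFutureCone hB hτ hj' hs
      refine ⟨i + 1, A', A + (c (i + 1) - c j + s • τ), a', a + 1, hA',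
        add_mem_closedFutureCone hB hτ hA hsum,
        by simpa using zero_mem_closedFutureCone, by omega, by omega, ?_, ?_, ?_⟩
      · rw [sub_self, add_zero, h, pow_succ, mul_neg_one, neg_smul, hW, ← sub_eq_add_neg]
        exact h2'
      · rw [← add_assoc, h1', h, pow_succ, mul_neg_one, neg_smul, hW]
        push_cast
        module
      · have e1 := hg.add_le A hA _ hsum
        have e2 := hg.sep_le _ hj' (c j)
        rw [add_sub_cancel] at e2
        have e3 := hD.nonneg (c (i + 1)) (c (i + 1))
        linarith

end IsShiftProfile

variable [FiniteDimensional ℝ V]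

/-- Translate p by a lattice vector into the future of x but within bounded distance. Then x + u +
sτ lies in the future of the translated end point, and the path from x through the translated pair
only gains length. -/
theorem IsPeriodicSeparation.exists_shift (hB : IsLorentzForm B) (hτ : B τ τ < 0)
    {Γ : Submodule ℤ V} [DiscreteTopology Γ] [IsZLattice ℝ Γ] {m M : ℝ}
    (hD : IsPeriodicSeparation B τ Γ m M D) :
    ∃ s : ℝ, 0 ≤ s ∧ ∀ x p, ∀ u ∈ closedFutureCone B τ,
      D p (p + u) ≤ D x (x + (u + s • τ)) := by
  obtain ⟨r, hr, hΓ⟩ := exists_norm_sub_mem_le Γ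
  obtain ⟨κ, hκ, hmem⟩ := exists_add_smul_mem hτ hτ
  refine ⟨2 * (κ * r), by positivity, fun x p u hu => ?_⟩
  obtain ⟨k, hk, hkr⟩ := hΓ (x - p + (κ * r) • τ)
  set w := k - (x - p + (κ * r) • τ) with hw
  have hκr : κ * ‖w‖ ≤ κ * r := by gcongr
  have h1 : (p + k) - x ∈ closedFutureCone B τ := by
    convert hmem w _ hκr using 1
    simp only [hw]; abel
  have h2 : (p + u + k) - (p + k) ∈ closedFutureCone B τ := by
    convert hu using 1
    abel
  have h3 : (x + (u + (2 * (κ * r)) • τ)) - (p + u + k) ∈ closedFutureCone B τ := by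
    convert hmem (-w) _ (by rwa [norm_neg] : κ * ‖-w‖ ≤ κ * r) using 1
    rw [hw]; module
  have h12 : (p + u + k) - x ∈ closedFutureCone B τ := by
    convert add_mem_closedFutureCone hB hτ h1 h2 using 1
    abel
  have e1 := hD.add_le x (p + k) (p + u + k) h1 h2
  have e2 := hD.add_le x (p + u + k) _ h12 h3
  rw [hD.periodic k hk] at e1
  have := hD.nonneg x (p + k)
  have := hD.nonneg (p + u + k) (x + (u + (2 * (κ * r)) • τ))
  linarith

/-- The profile is the infimum over base points: superadditivity passes to it, and `exists_shift` is
the comparison in the other direction. -/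
theorem IsPeriodicSeparation.exists_isShiftProfile (hB : IsLorentzForm B) (hτ : B τ τ < 0)
    {Γ : Submodule ℤ V} [DiscreteTopology Γ] [IsZLattice ℝ Γ] {m M : ℝ}
    (hD : IsPeriodicSeparation B τ Γ m M D) :
    ∃ (s : ℝ) (g : V → ℝ), IsShiftProfile B τ D s g ∧
      ∀ u ∈ closedFutureCone B τ, m * formAbs B u ≤ g u := by
  obtain ⟨s, hs, hshift⟩ := hD.exists_shift hB hτ
  have hbdd : ∀ u, BddBelow (range fun p => D p (p + u)) := fun u =>
    ⟨0, by rintro _ ⟨p, rfl⟩; exact hD.nonneg _ _⟩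
  refine ⟨s, fun u => ⨅ p, D p (p + u), ⟨hs, fun u => Real.iInf_nonneg fun p => hD.nonneg _ _,
    fun u hu w hw => ?_, fun u _ p => ciInf_le (hbdd u) p, fun u hu p => ?_⟩, fun u hu => ?_⟩
  · refine le_ciInf fun p => ?_
    have h1 := ciInf_le (hbdd u) p
    have h2 := ciInf_le (hbdd w) (p + u)
    have h3 := hD.add_le p (p + u) (p + u + w) (by simpa using hu) (by simpa using hw)
    rw [← add_assoc]
    linarith
  · exact le_ciInf fun x => hshift x p u hu
  · refine le_ciInf fun p => ?_
    simpa using hD.formAbs_le p (p + u) (by simpa using hu)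

namespace IsShiftProfile

/-- A balanced cut of an almost longest chain puts half of the displacement, up to a bounded error,
into the pieces of each sign; `sum_chain_le` compares the length with the values of g at these two
sums. -/
theorem exists_halving (hB : IsLorentzForm B) (hτ : B τ τ < 0) {Γ : Submodule ℤ V} {m M s : ℝ}
    (hD : IsPeriodicSeparation B τ Γ m M D) (hg : IsShiftProfile B τ D s g) :
    ∃ r : ℝ, 0 ≤ r ∧ ∀ u ∈ closedFutureCone B τ, g u ≤ 1 + 2 * g ((1 / 2 : ℝ) • u + r • τ) := by
  obtain ⟨C, hC, hcut⟩ := exists_balanced_cut V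
  obtain ⟨κ, hκ, hmem⟩ := exists_add_smul_mem hτ hτ
  set d := Module.finrank ℝ V
  have hs := hg.shift_nonneg
  have hτC : τ ∈ closedFutureCone B τ := futureCone_subset (mem_futureCone_self hτ)
  -- The term κC absorbs the imbalance, of norm at most C/2; (d + 1)s pays one shift for each of at
  -- most d + 1 pieces.
  refine ⟨κ * C + (d + 1) * s, by positivity, fun u hu => ?_⟩
  obtain ⟨N, c, hc0, hcN, hc, hsum⟩ := hD.exists_chain 0 u (by simpa using hu)
  obtain ⟨S, hS, hbal⟩ := hcut N (fun j => c (j + 1) - c j) fun j => (hc j j.2).2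
  -- The number of cuts before step i, so that (-1)^(n i) is `cutSign S` at i.
  let n : ℕ → ℕ := fun i => (S.filter fun j : Fin N => (j : ℕ) < i).card
  have hnd : ∀ i, n i ≤ d := fun i => (Finset.card_filter_le _ _).trans hS
  have hn : ∀ i, n (i + 1) = n i ∨ n (i + 1) = n i + 1 := by
    intro i
    have hle : n i ≤ n (i + 1) :=
      Finset.card_le_card fun j hj => by
        simp only [Finset.mem_filter] at hj ⊢
        exact ⟨hj.1, by omega⟩
    have hle' : n (i + 1) ≤ n i + 1 := by
      by_cases hi : i < N
      · refine (Finset.card_le_card (t := insert ⟨i, hi⟩ (S.filter fun j : Fin N => (j : ℕ) < i))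
          fun j hj => ?_).trans (Finset.card_insert_le _ _)
        simp only [Finset.mem_filter, Finset.mem_insert] at hj ⊢
        by_cases hji : (j : ℕ) = i
        · exact Or.inl (Fin.ext hji)
        · exact Or.inr ⟨hj.1, by omega⟩
      · refine (Finset.card_le_card fun j hj => ?_).trans (Nat.le_succ _)
        simp only [Finset.mem_filter] at hj ⊢
        exact ⟨hj.1, by omega⟩
    omega
  obtain ⟨j, A, A', a, a', hA, hA', hj, ha, ha', h1, h2, h3⟩ :=
    hg.sum_chain_le hB hτ hD (fun i hi => (hc i hi).1) n hn (by simp [n]) N le_rfl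
  have hW : ‖∑ k ∈ Finset.range N, (-1 : ℝ) ^ n k • (c (k + 1) - c k)‖ ≤ C := by
    rw [← Fin.sum_univ_eq_sum_range (fun k => (-1 : ℝ) ^ n k • (c (k + 1) - c k)) N]
    exact hbal
  set W := (-1 : ℝ) ^ n N • ∑ k ∈ Finset.range N, (-1 : ℝ) ^ n k • (c (k + 1) - c k) with hWdef
  have hWC : ‖W‖ ≤ C := by
    rw [hWdef, norm_smul, norm_pow, norm_neg, norm_one, one_pow, one_mul]
    exact hW
  rw [hc0, hcN, sub_zero] at h1 h2
  have hclose : ∀ (ε : ℝ) (b : ℕ), |ε| = 1 → b ≤ d + 1 →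
      ((1 / 2 : ℝ) • u + (κ * C + (d + 1) * s) • τ) -
        ((1 / 2 : ℝ) • (u + ε • W) + ((b : ℝ) * s) • τ) ∈ closedFutureCone B τ := by
    intro ε b hε hb
    have hb' : (b : ℝ) ≤ d + 1 := by exact_mod_cast hb
    convert add_mem_closedFutureCone hB hτ (hmem (-((1 / 2 * ε) • W)) (κ * C) ?_)
      (smul_mem_closedFutureCone (mul_nonneg (sub_nonneg.2 hb') hs) hτC) using 1
    · module
    · rw [norm_neg, norm_smul, norm_mul, Real.norm_eq_abs ε, hε]
      have : ‖(1 / 2 : ℝ)‖ = 1 / 2 := by norm_num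
      rw [this]
      gcongr
      linarith [norm_nonneg W]
  have hcj := hg.sep_le _ hj (c j)
  rw [add_sub_cancel, hcN] at hcj
  have hsτ : s • τ ∈ closedFutureCone B τ := smul_mem_closedFutureCone hs hτC
  rw [hcN] at hj
  have hjs := add_mem_closedFutureCone hB hτ hj hsτ
  have hadd := hg.add_le A hA _ hjs
  have hA1 : g (A + (u - c j + s • τ)) ≤ g ((1 / 2 : ℝ) • u + (κ * C + (d + 1) * s) • τ) := by
    refine hg.mono (add_mem_closedFutureCone hB hτ hA hjs) ?_
    convert hclose 1 (a + 1) (by simp) (by have := hnd N; omega) using 2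
    rw [← add_assoc, h1]
    push_cast
    module
  have hA2 : g A' ≤ g ((1 / 2 : ℝ) • u + (κ * C + (d + 1) * s) • τ) := by
    refine hg.mono hA' ?_
    convert hclose (-1) a' (by simp) (by have := hnd N; omega) using 2
    rw [h2]
    module
  have hgu := hg.le_sep u hu 0
  rw [zero_add] at hgu
  rw [hcN] at h3
  linarith

end IsShiftProfile

end Asymptotics

/-! ### The stable time separation -/

section Asymptotics

variable {V : Type*} [NormedAddCommGroup V] [NormedSpace ℝ V]
  {B : LinearMap.BilinForm ℝ V} {τ : V} {D : V → V → ℝ} {g : V → ℝ}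

/-- The defining properties of the stable time separation `l` associated to `g`. -/
structure IsStableSeparation (B : LinearMap.BilinForm ℝ V) (τ : V) (g l : V → ℝ) (r : ℝ) :
    Prop where
  shift_nonneg : 0 ≤ r
  tendsto : ∀ u ∈ closedFutureCone B τ, Tendsto (fun s : ℝ => g (s • u) / s) atTop (𝓝 (l u))
  le : ∀ u ∈ closedFutureCone B τ, g u ≤ l u
  le_shift : ∀ u ∈ closedFutureCone B τ, l u ≤ g (u + r • τ) + 1

namespace IsStableSeparation

variable {l : V → ℝ} {s r m M : ℝ} {Γ : Submodule ℤ V}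

theorem nonneg (hg : IsShiftProfile B τ D s g) (hl : IsStableSeparation B τ g l r) {u : V}
    (hu : u ∈ closedFutureCone B τ) : 0 ≤ l u :=
  (hg.nonneg u).trans (hl.le u hu)

theorem le_formAbs (hD : IsPeriodicSeparation B τ Γ m M D) (hg : IsShiftProfile B τ D s g)
    (hl : IsStableSeparation B τ g l r) {u : V} (hu : u ∈ closedFutureCone B τ) :
    l u ≤ M * formAbs B u := by
  refine le_of_tendsto (hl.tendsto u hu) ?_
  filter_upwards [eventually_gt_atTop 0] with t ht
  have htu := smul_mem_closedFutureCone ht.le hu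
  have h1 := hg.le_sep _ htu 0
  have h2 := hD.le_formAbs 0 (0 + t • u) (by simpa using htu)
  rw [add_sub_cancel_left, formAbs_smul, abs_of_pos ht] at h2
  rw [div_le_iff₀ ht]
  linarith

theorem smul (hD : IsPeriodicSeparation B τ Γ m M D) (hg : IsShiftProfile B τ D s g)
    (hl : IsStableSeparation B τ g l r) {c : ℝ} (hc : 0 ≤ c) {u : V}
    (hu : u ∈ closedFutureCone B τ) : l (c • u) = c * l u := by
  rcases hc.eq_or_lt with rfl | hc
  · have h0 := hl.le_formAbs hD hg (zero_mem_closedFutureCone (B := B) (τ := τ))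
    rw [show formAbs B (0 : V) = 0 by simp [formAbs], mul_zero] at h0
    rw [zero_smul, zero_mul]
    exact le_antisymm h0 (hl.nonneg hg zero_mem_closedFutureCone)
  · refine tendsto_nhds_unique (hl.tendsto _ (smul_mem_closedFutureCone hc.le hu)) ?_
    have h1 : Tendsto (fun t : ℝ => c * (g ((t * c) • u) / (t * c))) atTop (𝓝 (c * l u)) :=
      ((hl.tendsto u hu).comp (tendsto_id.atTop_mul_const hc)).const_mul c
    refine h1.congr' ?_
    filter_upwards [eventually_gt_atTop 0] with t ht
    rw [smul_smul]
    field_simp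

theorem add_le (hg : IsShiftProfile B τ D s g) (hB : IsLorentzForm B) (hτ : B τ τ < 0)
    (hl : IsStableSeparation B τ g l r) {u w : V}
    (hu : u ∈ closedFutureCone B τ) (hw : w ∈ closedFutureCone B τ) :
    l u + l w ≤ l (u + w) := by
  refine le_of_tendsto_of_tendsto ((hl.tendsto u hu).add (hl.tendsto w hw))
    (hl.tendsto _ (add_mem_closedFutureCone hB hτ hu hw)) ?_
  filter_upwards [eventually_gt_atTop 0] with t ht
  rw [← add_div, smul_add]
  exact div_le_div_of_nonneg_right (hg.add_le _ (smul_mem_closedFutureCone ht.le hu) _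
    (smul_mem_closedFutureCone ht.le hw)) ht.le

theorem mono (hg : IsShiftProfile B τ D s g) (hB : IsLorentzForm B) (hτ : B τ τ < 0)
    (hl : IsStableSeparation B τ g l r) {u w : V}
    (hu : u ∈ closedFutureCone B τ) (hw : w - u ∈ closedFutureCone B τ) : l u ≤ l w := by
  have := hl.add_le hg hB hτ hu hw
  rw [add_sub_cancel] at this
  linarith [hl.nonneg hg hw]

theorem concaveOn (hD : IsPeriodicSeparation B τ Γ m M D) (hg : IsShiftProfile B τ D s g)
    (hB : IsLorentzForm B) (hτ : B τ τ < 0) (hl : IsStableSeparation B τ g l r) :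
    ConcaveOn ℝ (closedFutureCone B τ) l := by
  refine ⟨convex_closedFutureCone hB hτ, fun x hx y hy a b ha hb _ => ?_⟩
  rw [smul_eq_mul, smul_eq_mul, ← hl.smul hD hg ha hx, ← hl.smul hD hg hb hy]
  exact hl.add_le hg hB hτ (smul_mem_closedFutureCone ha hx) (smul_mem_closedFutureCone hb hy)

end IsStableSeparation

variable [FiniteDimensional ℝ V]

/-- Fekete's lemma on each ray gives the limit and the lower bound; iterated halving along the
scales 2^k gives the upper bound. -/
theorem IsShiftProfile.exists_isStableSeparation (hB : IsLorentzForm B) (hτ : B τ τ < 0)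
    {Γ : Submodule ℤ V} {m M s : ℝ} (hD : IsPeriodicSeparation B τ Γ m M D)
    (hg : IsShiftProfile B τ D s g) : ∃ (l : V → ℝ) (r : ℝ), IsStableSeparation B τ g l r := by
  have hex : ∀ u, ∃ L, u ∈ closedFutureCone B τ →
      Tendsto (fun s : ℝ => g (s • u) / s) atTop (𝓝 L) ∧ ∀ s, 0 < s → g (s • u) / s ≤ L := by
    intro u
    by_cases hu : u ∈ closedFutureCone B τ
    · obtain ⟨L, hL⟩ := exists_tendsto_div_of_superadditive (h := fun s : ℝ => g (s • u))
        (K := M * formAbs B u) (fun s => hg.nonneg _) (fun s t hs ht => by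
          rw [add_smul]
          exact hg.add_le _ (smul_mem_closedFutureCone hs hu) _ (smul_mem_closedFutureCone ht hu))
        (fun s hs => by
          have hsu := smul_mem_closedFutureCone hs hu
          have h1 := hg.le_sep _ hsu 0
          have h2 := hD.le_formAbs 0 (0 + s • u) (by simpa using hsu)
          rw [add_sub_cancel_left, formAbs_smul, abs_of_nonneg hs] at h2
          calc g (s • u) ≤ _ := h1.trans h2
            _ = _ := by ring)
      exact ⟨L, fun _ => hL⟩
    · exact ⟨0, fun h => absurd h hu⟩
  choose l hl using hex
  obtain ⟨r, hr, hhalf⟩ := hg.exists_halving hB hτ hD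
  have hτC : τ ∈ closedFutureCone B τ := futureCone_subset (mem_futureCone_self hτ)
  -- 2r is the fixed point of c ↦ c/2 + r, so repeated halving keeps the same shift. The additive
  -- errors sum to 2^k - 1, which becomes at most 1 after division by 2^k.
  refine ⟨l, 2 * r, by positivity, fun u hu => (hl u hu).1, fun u hu => ?_, fun u hu => ?_⟩
  · simpa using (hl u hu).2 1 one_pos
  · have hrτ : (2 * r) • τ ∈ closedFutureCone B τ :=
      smul_mem_closedFutureCone (by positivity) hτC
    have hpow : ∀ k : ℕ, g ((2 : ℝ) ^ k • u + (2 * r) • τ) ≤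
        (2 : ℝ) ^ k * g (u + (2 * r) • τ) + ((2 : ℝ) ^ k - 1) := by
      intro k
      induction k with
      | zero => simp
      | succ k ih =>
        have h1 := hhalf ((2 : ℝ) ^ (k + 1) • u + (2 * r) • τ) (add_mem_closedFutureCone hB hτ
          (smul_mem_closedFutureCone (by positivity) hu) hrτ)
        have h2 : (1 / 2 : ℝ) • ((2 : ℝ) ^ (k + 1) • u + (2 * r) • τ) + r • τ =
            (2 : ℝ) ^ k • u + (2 * r) • τ := by
          rw [pow_succ]
          module
        rw [h2] at h1
        calc _ ≤ _ := h1
          _ ≤ 1 + 2 * ((2 : ℝ) ^ k * g (u + (2 * r) • τ) + ((2 : ℝ) ^ k - 1)) := by gcongr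
          _ = _ := by ring
    have hlim : Tendsto (fun k : ℕ => g ((2 : ℝ) ^ k • u) / (2 : ℝ) ^ k) atTop (𝓝 (l u)) :=
      (hl u hu).1.comp (tendsto_pow_atTop_atTop_of_one_lt one_lt_two)
    refine le_of_tendsto' hlim fun k => ?_
    have hk : (0 : ℝ) < 2 ^ k := by positivity
    have hku := smul_mem_closedFutureCone hk.le hu
    have h1 := hg.mono hku (w := (2 : ℝ) ^ k • u + (2 * r) • τ) (by simpa using hrτ)
    rw [div_le_iff₀ hk]
    linarith [hpow k]

namespace IsStableSeparation

variable {l : V → ℝ} {s r m M : ℝ} {Γ : Submodule ℤ V}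

/-- For null v both sides vanish. For timelike v the shift sτ is dominated by a fixed multiple qv,
so D(x, x+nv) lies between g(nv) and g((n+q)v). -/
theorem tendsto_sep (hD : IsPeriodicSeparation B τ Γ m M D) (hg : IsShiftProfile B τ D s g)
    (hB : IsLorentzForm B) (hτ : B τ τ < 0) (hl : IsStableSeparation B τ g l r) {v : V}
    (hv : v ∈ closedFutureCone B τ) (x : V) :
    Tendsto (fun n : ℕ => D x (x + (n : ℝ) • v) / n) atTop (𝓝 (l v)) := by
  by_cases hv0 : v = 0
  · subst hv0
    have h0 := hl.smul hD hg le_rfl hv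
    rw [zero_smul, zero_mul] at h0
    have hx := hD.le_formAbs x x (by simpa using zero_mem_closedFutureCone)
    rw [sub_self, show formAbs B (0 : V) = 0 by simp [formAbs], mul_zero] at hx
    simp [h0, le_antisymm hx (hD.nonneg _ _)]
  have hvT := (mem_futureCone_iff hB hτ).2 ⟨hv, hv0⟩
  rcases hv.1.eq_or_lt with h | h
  · have hf : formAbs B v = 0 := by simp [formAbs, h]
    have h1 := hl.le_formAbs hD hg hv
    rw [hf, mul_zero] at h1
    rw [le_antisymm h1 (hl.nonneg hg hv)]
    have h2 : ∀ n : ℕ, D x (x + (n : ℝ) • v) = 0 := fun n => by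
      have hn := hD.le_formAbs x (x + (n : ℝ) • v)
        (by simpa using smul_mem_closedFutureCone n.cast_nonneg hv)
      rw [add_sub_cancel_left, formAbs_smul, hf, mul_zero, mul_zero] at hn
      exact le_antisymm hn (hD.nonneg _ _)
    simp [h2]
  · obtain ⟨κ, hκ, hmem⟩ := exists_add_smul_mem h hvT.2.2
    set q := κ * ‖-(s • τ)‖ with hq
    have hqv : q • v - s • τ ∈ closedFutureCone B τ := by
      rw [sub_eq_add_neg]
      exact hmem _ _ le_rfl
    have hcast : Tendsto (fun n : ℕ => (n : ℝ)) atTop atTop := tendsto_natCast_atTop_atTop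
    have hlow := (hl.tendsto v hv).comp hcast
    have hq' : Tendsto (fun n : ℕ => (n : ℝ) + q) atTop atTop :=
      tendsto_atTop_add_const_right _ _ hcast
    have hratio : Tendsto (fun n : ℕ => 1 + q / (n : ℝ)) atTop (𝓝 (1 + 0)) :=
      tendsto_const_nhds.add (tendsto_const_nhds.div_atTop hcast)
    have hup := ((hl.tendsto v hv).comp hq').mul hratio
    rw [add_zero, mul_one] at hup
    refine tendsto_of_tendsto_of_tendsto_of_le_of_le' hlow hup ?_ ?_
    · filter_upwards with n
      exact div_le_div_of_nonneg_right
        (hg.le_sep _ (smul_mem_closedFutureCone n.cast_nonneg hv) x) n.cast_nonneg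
    · filter_upwards [eventually_gt_atTop 0] with n hn
      have hn : (0 : ℝ) < n := by exact_mod_cast hn
      have hnv := smul_mem_closedFutureCone hn.le hv
      have hq0 : 0 ≤ q := by positivity
      have h1 := hg.sep_le _ hnv x
      have h2 : g ((n : ℝ) • v + s • τ) ≤ g (((n : ℝ) + q) • v) := by
        refine hg.mono (add_mem_closedFutureCone hB hτ hnv (smul_mem_closedFutureCone
          hg.shift_nonneg (futureCone_subset (mem_futureCone_self hτ)))) ?_
        convert hqv using 1
        module
      have h3 : g (((n : ℝ) + q) • v) / ((n : ℝ) + q) * (1 + q / n) =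
          g (((n : ℝ) + q) • v) / n := by
        have : (n : ℝ) + q ≠ 0 := by positivity
        field_simp
      simp only [Function.comp_apply]
      rw [h3]
      exact div_le_div_of_nonneg_right (h1.trans h2) hn.le

/-- Up to the constant 1, both l v and D(x, x+v) lie between l(v-rτ) and l(v+(s+1)τ). To bound the
gap, go from the upper point through the lower one on to a point at distance of order ‖v‖ still in
the cone: concavity loses only a fraction of order 1/‖v‖ of l, which has linear growth. -/
theorem exists_abs_sub_le (hD : IsPeriodicSeparation B τ Γ m M D) (hg : IsShiftProfile B τ D s g)
    (hB : IsLorentzForm B) (hτ : B τ τ < 0) (hM : 0 ≤ M) (hl : IsStableSeparation B τ g l r)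
    {ε : ℝ} (hε : 0 < ε) :
    ∃ K : ℝ, 0 < K ∧ ∀ v, Metric.ball v (ε * ‖v‖) ⊆ closedFutureCone B τ →
      v ∈ closedFutureCone B τ → ∀ x, |l v - D x (x + v)| ≤ K := by
  obtain ⟨C, hC, hCle⟩ := exists_formAbs_le B
  have hτC : τ ∈ closedFutureCone B τ := futureCone_subset (mem_futureCone_self hτ)
  have hr := hl.shift_nonneg
  have hs := hg.shift_nonneg
  have hτ0 : 0 < ‖τ‖ := norm_pos_iff.2 (mem_futureCone_self hτ).1
  -- The distance along τ between the two comparison points; the added 1 only keeps a and R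
  -- positive.
  set a := r + s + 1 with ha
  have ha0 : 0 < a := by positivity
  set R := 2 * (a * ‖τ‖) / ε with hR
  have hR0 : 0 < R := by positivity
  refine ⟨M * (C * (R + R * ε)) + 1, by positivity, fun v hball hv x => ?_⟩
  have hlD : ∀ x, D x (x + v) ≤ l (v + (s + 1) • τ) := fun x => by
    have hvs := add_mem_closedFutureCone hB hτ hv (smul_mem_closedFutureCone hs hτC)
    refine ((hg.sep_le v hv x).trans (hl.le _ hvs)).trans (hl.mono hg hB hτ hvs ?_)
    convert hτC using 1
    module
  rcases le_or_gt ‖v‖ R with hvR | hvR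
  · have h1 : formAbs B v ≤ C * (R + R * ε) := by
      refine (hCle v).trans ?_
      gcongr
      nlinarith
    have h2 : M * formAbs B v ≤ M * (C * (R + R * ε)) := by gcongr
    have h3 := hl.le_formAbs hD hg hv
    have h4 := hD.le_formAbs x (x + v) (by simpa using hv)
    rw [add_sub_cancel_left] at h4
    have h5 := hl.nonneg hg hv
    have h6 := hD.nonneg x (x + v)
    rw [abs_le]
    constructor <;> linarith
  · have hv0 : 0 < ‖v‖ := hR0.trans hvR
    have hεv : 2 * (a * ‖τ‖) < ε * ‖v‖ := by
      rw [hR, div_lt_iff₀ hε] at hvR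
      linarith
    have hdeep : ∀ b : ℝ, 0 ≤ b → b * ‖τ‖ < ε * ‖v‖ → v - b • τ ∈ closedFutureCone B τ := by
      intro b hb hlt
      apply hball
      rw [Metric.mem_ball, dist_eq_norm, sub_sub_cancel_left, norm_neg, norm_smul,
        Real.norm_eq_abs, abs_of_nonneg hb]
      exact hlt
    set w := v - r • τ with hw
    have hwC : w ∈ closedFutureCone B τ := by
      refine hdeep r hr (lt_of_le_of_lt ?_ hεv)
      have : r ≤ a := by linarith
      nlinarith [mul_le_mul_of_nonneg_right this hτ0.le, mul_pos ha0 hτ0]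
    -- Chosen so that (a/t)τ has norm ε‖v‖/2, inside the ball that lies in the cone; ‖v‖ > R ensures
    -- t ≤ 1.
    set t := 2 * (a * ‖τ‖) / (ε * ‖v‖) with ht
    have ht0 : 0 < t := by positivity
    have ht1 : t ≤ 1 := by
      rw [ht, div_le_one (by positivity)]
      exact hεv.le
    set z := v + (s + 1) • τ with hz
    have hzC : z ∈ closedFutureCone B τ :=
      add_mem_closedFutureCone hB hτ hv (smul_mem_closedFutureCone (by positivity) hτC)
    have hyC : z - (a / t) • τ ∈ closedFutureCone B τ := by
      have h1 : a / t * ‖τ‖ = ε * ‖v‖ / 2 := by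
        rw [ht]
        field_simp
      have h2 := hdeep (a / t) (by positivity) (by rw [h1]; linarith [mul_pos hε hv0])
      convert add_mem_closedFutureCone hB hτ h2
        (smul_mem_closedFutureCone (by positivity : 0 ≤ s + 1) hτC) using 1
      rw [hz]
      abel
    have hconc := (hl.concaveOn hD hg hB hτ).2 hzC hyC (sub_nonneg.2 ht1) ht0.le
      (sub_add_cancel 1 t)
    have hcomb : (1 - t) • z + t • (z - (a / t) • τ) = w := by
      rw [smul_sub, smul_smul, mul_div_cancel₀ _ ht0.ne', hz, hw, ha]
      module
    rw [hcomb, smul_eq_mul, smul_eq_mul] at hconc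
    have hy0 := mul_nonneg ht0.le (hl.nonneg hg hyC)
    have hznorm : t * ‖z‖ ≤ R + R * ε := by
      have h1 : ‖z‖ ≤ ‖v‖ + ε * ‖v‖ := by
        refine (norm_add_le _ _).trans ?_
        rw [norm_smul, Real.norm_eq_abs, abs_of_nonneg (by positivity)]
        have : s + 1 ≤ a := by linarith
        nlinarith [mul_le_mul_of_nonneg_right this hτ0.le, mul_pos ha0 hτ0]
      calc t * ‖z‖ ≤ t * (‖v‖ + ε * ‖v‖) := by gcongr
        _ = R + R * ε := by
          rw [ht, hR]
          field_simp
    have hloss : t * l z ≤ M * (C * (R + R * ε)) := by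
      calc t * l z ≤ t * (M * (C * ‖z‖)) := by
            gcongr
            refine (hl.le_formAbs hD hg hzC).trans ?_
            gcongr
            exact hCle z
        _ = M * (C * (t * ‖z‖)) := by ring
        _ ≤ _ := by gcongr
    have hlw : l w ≤ D x (x + v) + 1 := by
      have h1 := hl.le_shift w hwC
      rw [hw, sub_add_cancel] at h1
      linarith [hg.le_sep v hv x]
    have hlv : l v ≤ l z := by
      refine hl.mono hg hB hτ hv ?_
      rw [hz, add_sub_cancel_left]
      exact smul_mem_closedFutureCone (by positivity) hτC
    have hwv : l w ≤ l v := by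
      refine hl.mono hg hB hτ hwC ?_
      rw [hw, sub_sub_cancel]
      exact smul_mem_closedFutureCone hr hτC
    have := hlD x
    rw [abs_le]
    constructor <;> linarith

end IsStableSeparation

end Asymptotics

/-! ### Bounds for the conformal factor and conclusion -/

theorem bddAbove_range_of_periodic {V : Type*} [NormedAddCommGroup V] [NormedSpace ℝ V]
    [FiniteDimensional ℝ V] {Γ : Submodule ℤ V} [DiscreteTopology Γ] [IsZLattice ℝ Γ] {f : V → ℝ}
    (hf : Continuous f) (hΓ : ∀ k ∈ Γ, ∀ x, f (x + k) = f x) : BddAbove (range f) := by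
  obtain ⟨r, -, hr⟩ := exists_norm_sub_mem_le Γ
  obtain ⟨M, hM⟩ := (isCompact_closedBall (0 : V) r).bddAbove_image hf.continuousOn
  refine ⟨M, ?_⟩
  rintro _ ⟨x, rfl⟩
  obtain ⟨k, hk, hkr⟩ := hr x
  rw [← hΓ (-k) (neg_mem hk)]
  refine hM ⟨_, ?_, rfl⟩
  rwa [mem_closedBall_zero_iff, ← norm_neg, neg_add, neg_neg, neg_add_eq_sub]

theorem proposition3p1 {V : Type*} [NormedAddCommGroup V] [NormedSpace ℝ V]
    [FiniteDimensional ℝ V]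
    (B : LinearMap.BilinForm ℝ V) (hB : IsLorentzForm B)
    (τ : V) (hτ : B τ τ < 0)
    (Γ : Submodule ℤ V) [DiscreteTopology Γ] [IsZLattice ℝ Γ]
    (f : V → ℝ) (hf : ContDiff ℝ ∞ f) (hfpos : ∀ x, 0 < f x)
    (hfΓ : ∀ k ∈ Γ, ∀ x, f (x + k) = f x) :
    (∀ x : V, ∀ v ∈ futureCone B τ, timeSeparation B τ f x (x + v) ≠ ⊤) ∧
    ∃ l : V → ℝ,
      (∀ v ∈ futureCone B τ, 0 ≤ l v) ∧
      (∀ c : ℝ, 0 < c → ∀ v ∈ futureCone B τ, l (c • v) = c * l v) ∧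
      ConcaveOn ℝ (futureCone B τ) l ∧
      (∀ ε : ℝ, 0 < ε → ∃ K : ℝ, 0 < K ∧ ∀ v ∈ futureSubcone B τ ε, ∀ x : V,
        |l v - (timeSeparation B τ f x (x + v)).toReal| ≤ K) ∧
      (∀ v ∈ futureCone B τ,
        (⨅ x, f x) * formAbs B v ≤ l v ∧ l v ≤ (⨆ x, f x) * formAbs B v) ∧
      (∀ v ∈ futureCone B τ, ∀ w ∈ futureCone B τ, l v + l w ≤ l (v + w)) ∧
      (∀ v ∈ futureCone B τ, ∀ x : V,
        Tendsto (fun n : ℕ => (timeSeparation B τ f x (x + (n : ℝ) • v)).toReal / n)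
          atTop (𝓝 (l v))) := by
  have hfc := hf.continuous
  have habove := bddAbove_range_of_periodic hfc hfΓ
  have hbelow : BddBelow (range f) := ⟨0, by rintro _ ⟨x, rfl⟩; exact (hfpos x).le⟩
  have hM : ∀ x, f x ≤ ⨆ x, f x := le_ciSup habove
  have hm : ∀ x, ⨅ x, f x ≤ f x := ciInf_le hbelow
  have hM0 : 0 ≤ ⨆ x, f x := (hfpos 0).le.trans (hM 0)
  have hD := isPeriodicSeparation_timeSeparation hB hτ hfc hfpos hm hM hfΓ
  obtain ⟨s, g, hg, hgm⟩ := hD.exists_isShiftProfile hB hτ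
  obtain ⟨l, r, hl⟩ := hg.exists_isStableSeparation hB hτ hD
  have hsub := futureCone_subset (B := B) (τ := τ)
  refine ⟨fun x v hv => ?_, l, fun v hv => hl.nonneg hg (hsub hv),
    fun c hc v hv => hl.smul hD hg hc.le (hsub hv),
    (hl.concaveOn hD hg hB hτ).subset hsub (convex_futureCone hB hτ), fun ε hε => ?_,
    fun v hv => ⟨(hgm v (hsub hv)).trans (hl.le v (hsub hv)), hl.le_formAbs hD hg (hsub hv)⟩,
    fun v hv w hw => hl.add_le hg hB hτ (hsub hv) (hsub hw),
    fun v hv x => hl.tendsto_sep hD hg hB hτ (hsub hv) x⟩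
  · exact ((timeSeparation_le hB hτ hfc hfpos hM (by simpa using hsub hv)).trans_lt
      ENNReal.ofReal_lt_top).ne
  · obtain ⟨K, hK, hle⟩ := hl.exists_abs_sub_le hD hg hB hτ hM0 hε
    exact ⟨K, hK, fun v hv x =>
      hle v ((ball_subset_of_le_infDist_frontier hv.1 hv.2).trans hsub) (hsub hv.1) x⟩
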